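/- **Setting.** Let $G=(V,E,c)$ be a finite undirected graph with edge costs $c_e\ge 0$, and let $\mathrm{Pair}:V\to V$ be an involution (a Steiner Forest instance). Let $\mathrm{OPT}$ be a minimum-cost subgraph of $G$ in which every $v$ is connected to $\mathrm{Pair}(v)$, with the fewest edges among all such subgraphs of minimum cost (so $\mathrm{OPT}$ is a forest). Let $0<\beta<1$ and $t:V\to\mathbb R_{\ge 0}$. **Moat growing.** Time $\tau$ starts at $0$, and $y_A=0$ for all $A\subseteq V$. At every moment some of the connected components of the graph of fully coloured edges are *active sets*. The value $y_A$ of every active set $A$ grows at unit rate, all other values stay constant, and an edge $e$ becomes fully coloured when $\sum_{A:\,e\in\delta(A)}y_A=c_e$, where $\delta(A)$ is the set of edges with exactly one endpoint in $A$. Merges at a moment are carried out before deactivations at that moment. In *legacy moat growing* a component $A$ is active while it contains some $v$ with $\mathrm{Pair}(v)\notin A$; let $t^-_v$ be the first moment at which $v$ and $\mathrm{Pair}(v)$ are connected in it. In *boosted moat growing* on $(t,t^*)$, where $t^*\ge t$, a component $A$ is active at time $\tau$ iff $t^*_v>\tau$ for some $v\in A$; the growth of an active set $A$ at time $\tau$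 counts towards $y_{\mathrm{base}}$ if $t_v>\tau$ for some $v\in A$, and towards $y_{\mathrm{boost}}$ otherwise. **Local search.** A boost action $B=(v,\tau)$ replaces $t^*_v$ by $\tau$. Its win is the resulting decrease of $y_{\mathrm{base}}$ and its loss the resulting increase of $y_{\mathrm{boost}}$; it is valuable if $\mathrm{Win}\ge(1+\beta)\,\mathrm{Loss}$. The boost actions considered are those $(v,\tau)$ with $\tau>t^*_v$ such that $\tau$ is a moment at which, in the moat growing with $t^*_v$ replaced by $\infty$, the active set containing $v$ merges with another active set. The local search on $(G,t,\beta)$ starts with $t^*=t$ and applies, in any order, valuable boost actions of this kind until none is left. Its *final execution* is boosted moat growing on $(t,t^*)$ with the resulting $t^*$. **Assignments.** In an execution, a vertex is active at a moment if it has been in active sets from the beginning up to that moment. A set of vertices is *actively connected* if its members stay in active sets from the beginning until all of them lie in the same connected component. An *assignment* is a function $r:2^V\times V\to\mathbb R_{\ge0}$ with $r_{A,v}\le y_A$ (the final value of $y_A$), and with $r_{A,v}>0$ only if $v\in A$ and $v$ is active at the moment at which the active set $A$ is formed; the sum $\sum_v r_{A,v}$ is not bounded by $y_A$. Put $r_v=\sum_{A\subseteq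 V}r_{A,v}$ and $r_{\max}(S)=\max_{v\in S}r_v$. Vertices with larger $t^-_v$ have higher priority; ties are broken by a fixed total order of $V$ in which no vertex lies strictly between a vertex and its pair. The assignment $r$ is *priority-based on $S$* if, whenever $v\in S$ and $r_{A,v}>0$, $v$ is the vertex of highest priority in $S\cap A$. **Lemma.** Consider the final execution of a local search on $(G,t,\beta)$. Let $S\subseteq V$ be a nonempty set of vertices that lies in a single connected component of $\mathrm{OPT}$ and is actively connected in this execution, and let $r$ be any assignment for this execution that is priority-based on $S$. Then $$\frac{6}{5+\beta}\Bigl(\sum_{v\in S}r_v-r_{\max}(S)\Bigr)\le c(T_S),$$ where $T_S$ is the minimal subtree of $\mathrm{OPT}$ containing all vertices of $S$ and $c(T_S)$ is the total cost of its edges. -/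

import Mathlib

/-!
Moat growing algorithms for the Steiner Forest problem, and the local search over their
fingerprints.  A moat growing process is determined by the instance and by the rule that
says which connected components are active at a given moment.  The process is run in the usual
discrete steps: from one event to the next one.
-/

/-- A Steiner Forest instance: a graph with nonnegative edge costs, and an involution that tells
to which vertex each vertex has to be connected (vertices without a demand are their own pair). -/
structure SteinerForest (V : Type*) where
  graph : SimpleGraph V
  cost : Sym2 V → ℝ
  cost_nonneg : ∀ e ∈ graph.edgeSet, 0 ≤ cost e
  pair : V → V
  pair_involutive : Function.Involutive pair

/-- The situation right after all events of the moment `time` have been processed: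
`growth S` is the growth duration `y_S` of the vertex set `S` so far. -/
structure MoatState (V : Type*) where
  time : ℝ
  growth : Finset V → ℝ

/-- What distinguishes one moat growing process from another: `active τ S` says that a connected
component `S` is active at the moment `τ`; `alarms` are the moments, besides those at which an edge
becomes fully coloured, at which a discrete step has to end. -/
structure MoatRule (V : Type*) where
  active : ℝ → Finset V → Prop
  alarms : Finset ℝ

namespace SteinerForest

noncomputable section

open scoped Classical

variable {V : Type*} [Fintype V] (I : SteinerForest V)

/-! ### Solutions and the optimal solution -/

/-- The total cost of a set of edges. -/
def edgeCost (A : Set (Sym2 V)) : ℝ := ∑ e : Sym2 V with e ∈ A, I.cost e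

/-- A subgraph that connects every vertex with its pair. -/
def IsSolution (F : SimpleGraph V) : Prop :=
  F ≤ I.graph ∧ ∀ v, F.Reachable v (I.pair v)

/-- A solution of minimum cost that has the fewest edges among the solutions of minimum cost.
(Costs being nonnegative, it is a forest.) -/
def IsOPT (F : SimpleGraph V) : Prop :=
  I.IsSolution F ∧
    (∀ F', I.IsSolution F' → I.edgeCost F.edgeSet ≤ I.edgeCost F'.edgeSet) ∧
    ∀ F', I.IsSolution F' → I.edgeCost F'.edgeSet = I.edgeCost F.edgeSet →
      F.edgeSet.ncard ≤ F'.edgeSet.ncard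

/-- `T` is the (inclusion-wise) minimal subtree of `F` that contains all vertices of `S`. -/
def IsMinimalSubtree (F : SimpleGraph V) (S : Finset V) (T : F.Subgraph) : Prop :=
  Minimal (fun T' : F.Subgraph => (S : Set V) ⊆ T'.verts ∧ T'.coe.IsTree) T

/-! ### Moat growing -/

/-- `e ∈ δ(S)`: exactly one endpoint of `e` lies in `S`. -/
def Cuts (S : Finset V) (e : Sym2 V) : Prop := ∃ u ∈ S, ∃ v ∉ S, e = s(u, v)

/-- The length of the coloured portion of the edge `e`. -/
def coloured (s : MoatState V) (e : Sym2 V) : ℝ :=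
  ∑ S : Finset V with Cuts S e, s.growth S

/-- The graph of all fully coloured edges.  The forest that the algorithm maintains is a spanning
forest of this graph, so both have the same connected components.  (The coloured portion of an edge
never exceeds its cost.) -/
def fullyColoured (s : MoatState V) : SimpleGraph V where
  Adj u v := I.graph.Adj u v ∧ I.cost s(u, v) ≤ coloured s s(u, v)
  symm := ⟨fun u v h => ⟨h.1.symm, by rw [Sym2.eq_swap]; exact h.2⟩⟩
  loopless := ⟨fun u h => I.graph.loopless.irrefl u h.1⟩

/-- The current connected component of the vertex `v`. -/
def component (s : MoatState V) (v : V) : Finset V :=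
  Finset.univ.filter fun w => (I.fullyColoured s).Reachable v w

/-- The family of the current connected components. -/
def components (s : MoatState V) : Finset (Finset V) := Finset.univ.image (I.component s)

/-- The family of the currently active sets. -/
def activeSets (R : MoatRule V) (s : MoatState V) : Finset (Finset V) :=
  (I.components s).filter (R.active s.time)

/-- How many of the components of the two endpoints `p.1`, `p.2` are active. -/
def activeEnds (R : MoatRule V) (s : MoatState V) (p : V × V) : ℕ :=
  (({I.component s p.1, I.component s p.2} : Finset (Finset V)) ∩ I.activeSets R s).card

/-- The edges between two different components, at least one of which is active. -/
def growingEdges (R : MoatRule V) (s : MoatState V) : Finset (V × V) :=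
  Finset.univ.filter fun p => I.graph.Adj p.1 p.2 ∧
    I.component s p.1 ≠ I.component s p.2 ∧ I.activeEnds R s p ≠ 0

/-- The durations until the possible next events: an edge between different components becomes
fully coloured, or an alarm goes off. -/
def waits (R : MoatRule V) (s : MoatState V) : Finset ℝ :=
  ((I.growingEdges R s).image fun p =>
      (I.cost s(p.1, p.2) - coloured s s(p.1, p.2)) / (I.activeEnds R s p : ℝ)) ∪
    (R.alarms.filter fun a => s.time < a).image fun a => a - s.time

/-- The process goes on: there is an active set, and there is a next event. -/
def Running (R : MoatRule V) (s : MoatState V) : Prop :=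
  (I.activeSets R s).Nonempty ∧ (I.waits R s).Nonempty

/-- One step of the process: all active sets grow until the next event. -/
def next (R : MoatRule V) (s : MoatState V) : MoatState V :=
  if h : I.Running R s then
    { time := s.time + (I.waits R s).min' h.2
      growth := fun S =>
        s.growth S + if S ∈ I.activeSets R s then (I.waits R s).min' h.2 else 0 }
  else s

/-- The state after `n` steps. -/
def stage (R : MoatRule V) (n : ℕ) : MoatState V :=
  (I.next R)^[n] { time := 0, growth := fun _ => 0 }

/-! Every moat growing process comes to an end. -/

theorem component_eq_iff (s : MoatState V) (u v : V) :
    I.component s u = I.component s v ↔ (I.fullyColoured s).Reachable u v := by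
  constructor
  · intro h
    have : v ∈ I.component s v := by simp [component]
    rw [← h] at this
    simpa [component] using this
  · intro h
    ext w
    simp only [component, Finset.mem_filter, Finset.mem_univ, true_and]
    exact ⟨fun h' => h.symm.trans h', fun h' => h.trans h'⟩

theorem waits_pos (R : MoatRule V) (s : MoatState V) {d : ℝ} (hd : d ∈ I.waits R s) : 0 < d := by
  rcases Finset.mem_union.1 hd with hd | hd
  · obtain ⟨p, hp, rfl⟩ := Finset.mem_image.1 hd
    simp only [growingEdges, Finset.mem_filter, Finset.mem_univ, true_and] at hp
    obtain ⟨hadj, hne, hact⟩ := hp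
    have hlt : coloured s s(p.1, p.2) < I.cost s(p.1, p.2) := by
      by_contra hcon
      apply hne
      rw [component_eq_iff]
      exact SimpleGraph.Adj.reachable ⟨hadj, not_lt.1 hcon⟩
    have : (0 : ℝ) < (I.activeEnds R s p : ℝ) := by exact_mod_cast Nat.pos_of_ne_zero hact
    exact div_pos (sub_pos.2 hlt) this
  · obtain ⟨a, ha, rfl⟩ := Finset.mem_image.1 hd
    exact sub_pos.2 (Finset.mem_filter.1 ha).2

theorem growth_le_next (R : MoatRule V) (s : MoatState V) (S : Finset V) :
    s.growth S ≤ (I.next R s).growth S := by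
  unfold next
  split_ifs with h
  · have := I.waits_pos R s (Finset.min'_mem _ h.2)
    dsimp only
    split_ifs <;> linarith
  · exact le_rfl

theorem fullyColoured_le_next (R : MoatRule V) (s : MoatState V) :
    I.fullyColoured s ≤ I.fullyColoured (I.next R s) := by
  intro u v h
  exact ⟨h.1, h.2.trans (Finset.sum_le_sum fun S _ => I.growth_le_next R s S)⟩

theorem components_next (R : MoatRule V) (s : MoatState V) :
    I.components (I.next R s) = (I.components s).image fun C =>
      Finset.univ.filter fun w => ∃ x ∈ C, (I.fullyColoured (I.next R s)).Reachable x w := by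
  unfold components
  rw [Finset.image_image]
  congr 1
  funext v
  ext w
  simp only [component, Function.comp, Finset.mem_filter, Finset.mem_univ, true_and]
  constructor
  · intro h
    exact ⟨v, SimpleGraph.Reachable.refl v, h⟩
  · rintro ⟨x, hx, h⟩
    exact (hx.mono (I.fullyColoured_le_next R s)).trans h

theorem card_components_next_le (R : MoatRule V) (s : MoatState V) :
    (I.components (I.next R s)).card ≤ (I.components s).card := by
  rw [components_next]
  exact Finset.card_image_le

theorem card_components_next_lt (R : MoatRule V) (s : MoatState V) {u v : V}
    (hne : I.component s u ≠ I.component s v)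
    (heq : (I.fullyColoured (I.next R s)).Reachable u v) :
    (I.components (I.next R s)).card < (I.components s).card := by
  refine lt_of_le_of_ne (I.card_components_next_le R s) fun hcard => hne ?_
  rw [components_next] at hcard
  refine Finset.card_image_iff.1 hcard (Finset.mem_coe.2 (Finset.mem_image_of_mem _ (by simp)))
    (Finset.mem_coe.2 (Finset.mem_image_of_mem _ (by simp))) ?_
  ext w
  simp only [component, Finset.mem_filter, Finset.mem_univ, true_and]
  constructor
  · rintro ⟨x, hx, h⟩
    exact ⟨v, SimpleGraph.Reachable.refl v,
      heq.symm.trans ((hx.mono (I.fullyColoured_le_next R s)).trans h)⟩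
  · rintro ⟨x, hx, h⟩
    exact ⟨u, SimpleGraph.Reachable.refl u,
      heq.trans ((hx.mono (I.fullyColoured_le_next R s)).trans h)⟩

theorem measure_next_lt (R : MoatRule V) (s : MoatState V) (h : I.Running R s) :
    (I.components (I.next R s)).card + (R.alarms.filter fun a => (I.next R s).time < a).card <
      (I.components s).card + (R.alarms.filter fun a => s.time < a).card := by
  have hmem := Finset.min'_mem _ h.2
  have hpos := I.waits_pos R s hmem
  have htime : (I.next R s).time = s.time + (I.waits R s).min' h.2 := by
    unfold next; rw [dif_pos h]
  have hsub : (R.alarms.filter fun a => (I.next R s).time < a) ⊆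
      R.alarms.filter fun a => s.time < a := by
    intro a ha
    simp only [Finset.mem_filter] at ha ⊢
    exact ⟨ha.1, by linarith [ha.2]⟩
  rcases Finset.mem_union.1 hmem with hm | hm
  · obtain ⟨p, hp, hpd⟩ := Finset.mem_image.1 hm
    simp only [growingEdges, Finset.mem_filter, Finset.mem_univ, true_and] at hp
    obtain ⟨hadj, hne, hact⟩ := hp
    have hk : (0 : ℝ) < (I.activeEnds R s p : ℝ) := by exact_mod_cast Nat.pos_of_ne_zero hact
    rw [div_eq_iff hk.ne'] at hpd
    refine Nat.add_lt_add_of_lt_of_le ?_ (Finset.card_le_card hsub)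
    refine I.card_components_next_lt R s hne (SimpleGraph.Adj.reachable ⟨hadj, ?_⟩)
    have hgrow : ∀ S, (I.next R s).growth S =
        s.growth S + if S ∈ I.activeSets R s then (I.waits R s).min' h.2 else 0 := by
      intro S; unfold next; rw [dif_pos h]
    have hcut : ({I.component s p.1, I.component s p.2} : Finset (Finset V)) ∩ I.activeSets R s ⊆
        (Finset.univ.filter fun S : Finset V => Cuts S s(p.1, p.2)).filter
          (· ∈ I.activeSets R s) := by
      intro S hS
      simp only [Finset.mem_inter, Finset.mem_insert, Finset.mem_singleton] at hS
      simp only [Finset.mem_filter, Finset.mem_univ, true_and]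
      refine ⟨?_, hS.2⟩
      have hnr : ¬ (I.fullyColoured s).Reachable p.1 p.2 := fun hr =>
        hne ((I.component_eq_iff s _ _).2 hr)
      rcases hS.1 with rfl | rfl
      · exact ⟨p.1, by simp [component], p.2, by simpa [component] using hnr, rfl⟩
      · exact ⟨p.2, by simp [component], p.1,
          by simpa [component] using fun hr => hnr (SimpleGraph.Reachable.symm hr),
          Sym2.eq_swap⟩
    have hcard := Finset.card_le_card hcut
    have hsum : coloured (I.next R s) s(p.1, p.2) = coloured s s(p.1, p.2) +
        (((Finset.univ.filter fun S : Finset V => Cuts S s(p.1, p.2)).filter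
          (· ∈ I.activeSets R s)).card : ℝ) * (I.waits R s).min' h.2 := by
      unfold coloured
      simp only [hgrow, Finset.sum_add_distrib]
      rw [← Finset.sum_filter, Finset.sum_const, nsmul_eq_mul]
    have hcard' : (I.activeEnds R s p : ℝ) ≤
        (((Finset.univ.filter fun S : Finset V => Cuts S s(p.1, p.2)).filter
          (· ∈ I.activeSets R s)).card : ℝ) := by exact_mod_cast hcard
    have := mul_le_mul_of_nonneg_right hcard' hpos.le
    rw [hsum]
    linarith
  · obtain ⟨a, ha, had⟩ := Finset.mem_image.1 hm
    refine Nat.add_lt_add_of_le_of_lt (I.card_components_next_le R s) (Finset.card_lt_card ?_)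
    refine Finset.ssubset_iff_subset_ne.2 ⟨hsub, fun heq => ?_⟩
    rw [← heq, Finset.mem_filter] at ha
    linarith [ha.2]

theorem exists_not_running (R : MoatRule V) : ∃ n, ¬ I.Running R (I.stage R n) := by
  by_contra hcon
  push Not at hcon
  have key : ∀ n, (I.components (I.stage R n)).card +
      (R.alarms.filter fun a => (I.stage R n).time < a).card + n ≤
      (I.components (I.stage R 0)).card +
      (R.alarms.filter fun a => (I.stage R 0).time < a).card := by
    intro n
    induction n with
    | zero => simp
    | succ n ih =>
      have h := I.measure_next_lt R _ (hcon n)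
      have hs : I.stage R (n + 1) = I.next R (I.stage R n) := by
        unfold stage; rw [Function.iterate_succ_apply']
      rw [hs]
      omega
  have := key ((I.components (I.stage R 0)).card +
      (R.alarms.filter fun a => (I.stage R 0).time < a).card + 1)
  omega

/-- The number of steps until the process ends. -/
def lastStage (R : MoatRule V) : ℕ := Nat.find (I.exists_not_running R)

/-- `y_S`: the growth duration of `S` during the whole process. -/
def finalGrowth (R : MoatRule V) (S : Finset V) : ℝ := (I.stage R (I.lastStage R)).growth S

/-- The vertex `v` is active up to (and including) stage `n`: it has been in active sets from the
beginning. -/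
def ActiveUpTo (R : MoatRule V) (n : ℕ) (v : V) : Prop :=
  ∀ m ≤ n, I.component (I.stage R m) v ∈ I.activeSets R (I.stage R m)

/-- The vertices of `S` are connected while active: there is a stage at which all of them lie in
the same connected component, and up to then all of them have been in active sets. -/
def ActivelyConnected (R : MoatRule V) (S : Finset V) : Prop :=
  ∃ n, (∀ u ∈ S, ∀ v ∈ S, I.component (I.stage R n) u = I.component (I.stage R n) v) ∧
    ∀ m < n, ∀ v ∈ S, I.component (I.stage R m) v ∈ I.activeSets R (I.stage R m)

/-- `v` belongs to the superactive set of the active set `S`. -/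
def InSuperactive (R : MoatRule V) (S : Finset V) (v : V) : Prop :=
  v ∈ S ∧ ∃ n, S ∈ I.activeSets R (I.stage R n) ∧
    (∀ m < n, S ∉ I.activeSets R (I.stage R m)) ∧ I.ActiveUpTo R n v

/-! ### Legacy moat growing and priorities -/

/-- In legacy moat growing a component is active as long as it contains a vertex whose pair lies
outside of it. -/
def legacyRule : MoatRule V where
  active _ S := ∃ v ∈ S, I.pair v ∉ S
  alarms := ∅

/-- The first moment at which `v` and its pair are connected in legacy moat growing. -/
def legacyTime (v : V) : ℝ :=
  sInf {τ | ∃ n, (I.stage I.legacyRule n).time = τ ∧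
    I.pair v ∈ I.component (I.stage I.legacyRule n) v}

/-- A total order of the vertices (given by ranks) that comes from ordering the demand pairs, and
then the two vertices within each pair: no vertex lies strictly between a vertex and its pair. -/
def IsTieBreaker (rank : V → ℕ) : Prop :=
  Function.Injective rank ∧ ∀ u w, ¬ (rank u < rank w ∧ rank w < rank (I.pair u))

/-- The priority of `u` is lower than the priority of `v`. -/
def PriorityLT (rank : V → ℕ) (u v : V) : Prop :=
  I.legacyTime u < I.legacyTime v ∨ (I.legacyTime u = I.legacyTime v ∧ rank u < rank v)

/-! ### Boosted moat growing and the local search -/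

/-- Boosted moat growing with base fingerprint `t` and boosted fingerprint `b`: a component is
active as long as it contains a vertex `v` with `b v > τ`. -/
def boostedRule (t b : V → ℝ) : MoatRule V where
  active τ S := ∃ v ∈ S, τ < b v
  alarms := Finset.univ.image t ∪ Finset.univ.image b

/-- `y_base`: the total growth of active sets at moments `τ` at which they contain a vertex `v` with
`t v > τ`. -/
def yBase (t b : V → ℝ) : ℝ :=
  ∑ n ∈ Finset.range (I.lastStage (boostedRule t b)),
    ∑ S ∈ I.activeSets (boostedRule t b) (I.stage (boostedRule t b) n)
      with ∃ v ∈ S, (I.stage (boostedRule t b) n).time < t v,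
      ((I.stage (boostedRule t b) (n + 1)).time - (I.stage (boostedRule t b) n).time)

/-- `y_boost`: the total growth of active sets at all other moments. -/
def yBoost (t b : V → ℝ) : ℝ :=
  ∑ n ∈ Finset.range (I.lastStage (boostedRule t b)),
    ∑ S ∈ I.activeSets (boostedRule t b) (I.stage (boostedRule t b) n)
      with ¬ ∃ v ∈ S, (I.stage (boostedRule t b) n).time < t v,
      ((I.stage (boostedRule t b) (n + 1)).time - (I.stage (boostedRule t b) n).time)

/-- The win of the boost action `(v, τ)`. -/
def win (t b : V → ℝ) (v : V) (τ : ℝ) : ℝ :=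
  I.yBase t b - I.yBase t (Function.update b v τ)

/-- The loss of the boost action `(v, τ)`. -/
def loss (t b : V → ℝ) (v : V) (τ : ℝ) : ℝ :=
  I.yBoost t (Function.update b v τ) - I.yBoost t b

/-- The boost action `(v, τ)` is valuable. -/
def Valuable (β : ℝ) (t b : V → ℝ) (v : V) (τ : ℝ) : Prop :=
  (1 + β) * I.loss t b v τ ≤ I.win t b v τ

/-- Moat growing with the fingerprint `b`, except that the fingerprint of `v` is infinite. -/
def foreverRule (b : V → ℝ) (v : V) : MoatRule V where
  active τ S := v ∈ S ∨ ∃ u ∈ S, τ < b u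
  alarms := Finset.univ.image b

/-- The boost action space: `τ > b v` is a moment at which, if the fingerprint of `v` were infinite,
the active set containing `v` would merge with another active set. -/
def IsBoostCandidate (b : V → ℝ) (v : V) (τ : ℝ) : Prop :=
  b v < τ ∧ ∃ n, (I.stage (foreverRule b v) (n + 1)).time = τ ∧
    ∃ D ∈ I.activeSets (foreverRule b v) (I.stage (foreverRule b v) n),
      D ≠ I.component (I.stage (foreverRule b v) n) v ∧
      D ⊆ I.component (I.stage (foreverRule b v) (n + 1)) v

/-- The boosted fingerprints that the local search on `(G, t, β)` may produce, by applying
valuable boost actions one after the other. -/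
inductive LocalSearchReaches (β : ℝ) (t : V → ℝ) : (V → ℝ) → Prop
  | start : LocalSearchReaches β t t
  | boost {b : V → ℝ} {v : V} {τ : ℝ} : LocalSearchReaches β t b → I.IsBoostCandidate b v τ →
      I.Valuable β t b v τ → LocalSearchReaches β t (Function.update b v τ)

/-- `b` is the boosted fingerprint with which a run of the local search ends: no valuable boost
action is left. -/
def IsLocalSearchOutput (β : ℝ) (t b : V → ℝ) : Prop :=
  I.LocalSearchReaches β t b ∧ ∀ v τ, I.IsBoostCandidate b v τ → ¬ I.Valuable β t b v τ

/-! ### Assignments -/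

/-- `r S v` is the portion of the growth of the set `S` that is assigned to the vertex `v`; growth
is assigned to vertices of the superactive set only.  There is no bound on the sum over `v`. -/
def IsAssignment (R : MoatRule V) (r : Finset V → V → ℝ) : Prop :=
  ∀ S v, 0 ≤ r S v ∧ r S v ≤ I.finalGrowth R S ∧ (0 < r S v → I.InSuperactive R S v)

/-- `r_v`: the total growth assigned to `v`. -/
def assigned (r : Finset V → V → ℝ) (v : V) : ℝ := ∑ S : Finset V, r S v

/-- The assignment `r` is priority-based on `S`: whenever growth of a set `A` is assigned to a
vertex `v` of `S`, then `v` is the vertex of highest priority in `S ∩ A`. -/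
def IsPriorityBased (rank : V → ℕ) (r : Finset V → V → ℝ) (S : Finset V) : Prop :=
  ∀ A, ∀ v ∈ S, 0 < r A v → v ∈ A ∧ ∀ u ∈ S, u ∈ A → u ≠ v → I.PriorityLT rank u v

end

end SteinerForest

/-!
Integrate over time the number of merges that are still missing to connect a set `X` of vertices,
and call this the excess of `X`. In a priority-based assignment all growth assigned to vertices of
`S` other than the one of highest priority comes from active sets that meet `S` but avoid that
vertex, so `∑ r_v - r_max` is at most the excess of `S`.

Let terminals have distances `a₁, …, aₖ` from a vertex `v`. If `v` is boosted until it has merged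
with all of them, the `i`-th terminal is connected to `v` from the moment `aᵢ / 2` on, and while the
boost creates an additional active set, no terminal has been reached yet, which ends before
`a₁ / 2`. As the boost is not valuable, the merges that it saves cannot outweigh this cost: the
excess of the terminals is at most `(∑ aᵢ + β a₁) / 2`.

The excess is subadditive for sets that share a vertex. Connecting `S` in six ways along stars and
paths of `T_S`, whose bounds add up to at most `(5 + β) c(T_S)`, therefore bounds six times the
excess of `S`.
-/

namespace SteinerForest

noncomputable section

open scoped Classical

open MeasureTheory

section Run

variable {V : Type*} [Fintype V] (I : SteinerForest V) (R : MoatRule V)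

/-! ### The discrete run of a moat growing process -/

/-- The moment of the `n`-th stage. -/
def moment (n : ℕ) : ℝ := (I.stage R n).time

/-- The vertices `u` and `w` lie in the same component of the fully coloured edges. -/
def Connected (s : MoatState V) (u w : V) : Prop := (I.fullyColoured s).Reachable u w

/-- The current component of the vertex `u` is active. -/
def IsActive (s : MoatState V) (u : V) : Prop := I.component s u ∈ I.activeSets R s

/-- The rate at which the edge `e` currently gets coloured: the number of active sets it leaves. -/
def rate (s : MoatState V) (e : Sym2 V) : ℕ := {A ∈ I.activeSets R s | Cuts A e}.card

variable {I R}

theorem cuts_mk_iff {V : Type*} {A : Finset V} {u w : V} :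
    Cuts A s(u, w) ↔ u ∈ A ∧ w ∉ A ∨ w ∈ A ∧ u ∉ A := by
  simp only [Cuts, Sym2.eq_iff]
  grind

section State

variable {s : MoatState V} {A : Finset V} {u w z : V}

theorem Connected.refl (u : V) : I.Connected s u u := SimpleGraph.Reachable.refl u

theorem Connected.symm (h : I.Connected s u w) : I.Connected s w u :=
  SimpleGraph.Reachable.symm h

theorem Connected.trans (h : I.Connected s u w) (h' : I.Connected s w z) : I.Connected s u z :=
  SimpleGraph.Reachable.trans h h'

theorem component_eq_iff_connected :
    I.component s u = I.component s w ↔ I.Connected s u w := I.component_eq_iff s u w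

theorem mem_component_iff : w ∈ I.component s u ↔ I.Connected s u w := by
  simp [component, Connected]

theorem mem_activeSets_iff :
    A ∈ I.activeSets R s ↔ (∃ u, I.component s u = A) ∧ R.active s.time A := by
  simp [activeSets, components]

theorem component_of_mem_activeSets (hA : A ∈ I.activeSets R s) (hu : u ∈ A) :
    I.component s u = A := by
  obtain ⟨⟨w, rfl⟩, -⟩ := mem_activeSets_iff.1 hA
  exact (component_eq_iff_connected.2 (mem_component_iff.1 hu)).symm

theorem rate_eq_zero_of_connected (h : I.Connected s u w) : I.rate R s s(u, w) = 0 := by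
  refine Finset.card_eq_zero.2 (Finset.filter_eq_empty_iff.2 fun A hA hcut => ?_)
  rcases cuts_mk_iff.1 hcut with ⟨hu, hw⟩ | ⟨hw, hu⟩
  · exact hw (component_of_mem_activeSets hA hu ▸ mem_component_iff.2 h)
  · exact hu (component_of_mem_activeSets hA hw ▸ mem_component_iff.2 h.symm)

theorem rate_eq_activeEnds (h : ¬ I.Connected s u w) :
    I.rate R s s(u, w) = I.activeEnds R s (u, w) := by
  unfold rate activeEnds
  congr 1
  ext A
  simp only [Finset.mem_filter, Finset.mem_inter, Finset.mem_insert, Finset.mem_singleton,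
    cuts_mk_iff]
  rw [and_comm]
  refine and_congr_left fun hA => ⟨?_, ?_⟩
  · rintro (⟨hu, -⟩ | ⟨hw, -⟩)
    · exact .inl (component_of_mem_activeSets hA hu).symm
    · exact .inr (component_of_mem_activeSets hA hw).symm
  · rintro (rfl | rfl)
    · exact .inl ⟨mem_component_iff.2 (.refl u), fun hw => h (mem_component_iff.1 hw)⟩
    · exact .inr ⟨mem_component_iff.2 (.refl w), fun hu => h (mem_component_iff.1 hu).symm⟩

theorem rate_eq_ite_add_ite (h : ¬ I.Connected s u w) :
    I.rate R s s(u, w) =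
      (if I.IsActive R s u then 1 else 0) + if I.IsActive R s w then 1 else 0 := by
  have hne : I.component s u ≠ I.component s w := component_eq_iff_connected.not.2 h
  rw [rate_eq_activeEnds h, activeEnds, ← Finset.filter_mem_eq_inter, Finset.filter_insert,
    Finset.filter_singleton]
  unfold IsActive
  split_ifs <;> simp [hne]

theorem rate_triangle (u w z : V) :
    I.rate R s s(u, z) ≤ I.rate R s s(u, w) + I.rate R s s(w, z) := by
  refine le_trans (Finset.card_le_card fun A => ?_) (Finset.card_union_le _ _)
  simp only [Finset.mem_filter, Finset.mem_union, cuts_mk_iff]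
  tauto

end State

variable (I R)

theorem stage_succ (n : ℕ) : I.stage R (n + 1) = I.next R (I.stage R n) := by
  rw [stage, Function.iterate_succ_apply', stage]

variable {I R}

theorem running_of_lt_lastStage {n : ℕ} (h : n < I.lastStage R) : I.Running R (I.stage R n) :=
  not_not.1 (Nat.find_min (I.exists_not_running R) h)

theorem not_running_lastStage : ¬ I.Running R (I.stage R (I.lastStage R)) :=
  Nat.find_spec (I.exists_not_running R)

theorem stage_of_lastStage_le {n : ℕ} (h : I.lastStage R ≤ n) :
    I.stage R n = I.stage R (I.lastStage R) := by
  induction n, h using Nat.le_induction with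
  | base => rfl
  | succ n _ ih => rw [stage_succ, ih, next, dif_neg not_running_lastStage]

theorem lt_lastStage_of_running {n : ℕ} (h : I.Running R (I.stage R n)) : n < I.lastStage R := by
  by_contra! hn
  exact not_running_lastStage (stage_of_lastStage_le hn ▸ h)

theorem moment_succ {n : ℕ} (h : I.Running R (I.stage R n)) :
    I.moment R (n + 1) = I.moment R n + (I.waits R (I.stage R n)).min' h.2 := by
  rw [moment, stage_succ, next, dif_pos h, moment]

theorem moment_succ_of_not_running {n : ℕ} (h : ¬ I.Running R (I.stage R n)) :
    I.moment R (n + 1) = I.moment R n := by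
  rw [moment, stage_succ, next, dif_neg h, moment]

theorem moment_lt_succ {n : ℕ} (h : n < I.lastStage R) : I.moment R n < I.moment R (n + 1) := by
  have hr := running_of_lt_lastStage h
  rw [moment_succ hr]
  linarith [I.waits_pos R _ (Finset.min'_mem _ hr.2)]

variable (I R)

@[simp] theorem moment_zero : I.moment R 0 = 0 := rfl

theorem moment_mono : Monotone (I.moment R) := by
  refine monotone_nat_of_le_succ fun n => ?_
  by_cases h : I.Running R (I.stage R n)
  · exact (moment_lt_succ (lt_lastStage_of_running h)).le
  · exact (moment_succ_of_not_running h).ge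

theorem moment_nonneg (n : ℕ) : 0 ≤ I.moment R n := I.moment_mono R n.zero_le

theorem growth_succ (n : ℕ) (A : Finset V) :
    (I.stage R (n + 1)).growth A = (I.stage R n).growth A +
      if A ∈ I.activeSets R (I.stage R n) then I.moment R (n + 1) - I.moment R n else 0 := by
  by_cases h : I.Running R (I.stage R n)
  · rw [moment_succ h, stage_succ, next, dif_pos h, add_sub_cancel_left]
  · rw [moment_succ_of_not_running h, stage_succ, next, dif_neg h, sub_self, ite_self, add_zero]

theorem growth_eq_sum (n : ℕ) (A : Finset V) :
    (I.stage R n).growth A = ∑ k ∈ Finset.range n,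
      if A ∈ I.activeSets R (I.stage R k) then I.moment R (k + 1) - I.moment R k else 0 := by
  induction n with
  | zero => simp [stage]
  | succ n ih => rw [growth_succ, ih, Finset.sum_range_succ]

theorem sum_growth_eq_sum (n : ℕ) (p : Finset V → Prop) [DecidablePred p] :
    ∑ A with p A, (I.stage R n).growth A = ∑ k ∈ Finset.range n,
      (I.moment R (k + 1) - I.moment R k) * {A ∈ I.activeSets R (I.stage R k) | p A}.card := by
  simp only [growth_eq_sum]
  rw [Finset.sum_comm]
  refine Finset.sum_congr rfl fun k _ => ?_
  rw [← Finset.sum_filter, Finset.sum_const, nsmul_eq_mul, mul_comm, Finset.filter_filter]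
  congr 3
  ext A
  simp [and_comm]

theorem coloured_eq_sum (n : ℕ) (e : Sym2 V) :
    coloured (I.stage R n) e =
      ∑ k ∈ Finset.range n, (I.moment R (k + 1) - I.moment R k) * I.rate R (I.stage R k) e :=
  I.sum_growth_eq_sum R n (Cuts · e)

theorem coloured_succ (n : ℕ) (e : Sym2 V) :
    coloured (I.stage R (n + 1)) e = coloured (I.stage R n) e +
      (I.moment R (n + 1) - I.moment R n) * I.rate R (I.stage R n) e := by
  rw [coloured_eq_sum, coloured_eq_sum, Finset.sum_range_succ]

theorem fullyColoured_stage_mono : Monotone fun n => I.fullyColoured (I.stage R n) :=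
  monotone_nat_of_le_succ fun n => I.stage_succ R n ▸ I.fullyColoured_le_next R _

variable {I R}

theorem coloured_lt_cost {s : MoatState V} {u w : V} (hadj : I.graph.Adj u w)
    (h : ¬ I.Connected s u w) : coloured s s(u, w) < I.cost s(u, w) :=
  not_le.1 fun hcon => h (SimpleGraph.Adj.reachable ⟨hadj, hcon⟩)

theorem div_rate_mem_waits {s : MoatState V} {u w : V} (hadj : I.graph.Adj u w)
    (h : ¬ I.Connected s u w) (hrate : I.rate R s s(u, w) ≠ 0) :
    (I.cost s(u, w) - coloured s s(u, w)) / I.rate R s s(u, w) ∈ I.waits R s := by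
  rw [rate_eq_activeEnds h] at hrate ⊢
  refine Finset.mem_union_left _ (Finset.mem_image.2 ⟨(u, w), ?_, rfl⟩)
  exact Finset.mem_filter.2 ⟨Finset.mem_univ _, hadj, component_eq_iff_connected.not.2 h, hrate⟩

theorem running_of_rate_ne_zero {s : MoatState V} {u w : V} (hadj : I.graph.Adj u w)
    (h : ¬ I.Connected s u w) (hrate : I.rate R s s(u, w) ≠ 0) : I.Running R s :=
  ⟨(Finset.card_ne_zero.1 hrate).mono (Finset.filter_subset _ _),
    ⟨_, div_rate_mem_waits hadj h hrate⟩⟩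

theorem coloured_succ_le_cost {n : ℕ} {u w : V} (hadj : I.graph.Adj u w)
    (h : ¬ I.Connected (I.stage R n) u w) :
    coloured (I.stage R (n + 1)) s(u, w) ≤ I.cost s(u, w) := by
  rw [coloured_succ]
  by_cases hrate : I.rate R (I.stage R n) s(u, w) = 0
  · simpa [hrate] using (coloured_lt_cost hadj h).le
  · have hmin := Finset.min'_le _ _ (div_rate_mem_waits hadj h hrate)
    have hpos : (0 : ℝ) < I.rate R (I.stage R n) s(u, w) := by
      exact_mod_cast Nat.pos_of_ne_zero hrate
    rw [le_div_iff₀ hpos] at hmin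
    rw [moment_succ (running_of_rate_ne_zero hadj h hrate), add_sub_cancel_left]
    linarith

theorem coloured_stage_le_cost {u w : V} (hadj : I.graph.Adj u w) (n : ℕ) :
    coloured (I.stage R n) s(u, w) ≤ I.cost s(u, w) := by
  induction n with
  | zero => simpa [coloured, stage] using I.cost_nonneg _ hadj
  | succ n ih =>
    by_cases h : I.Connected (I.stage R n) u w
    · simpa [coloured_succ, rate_eq_zero_of_connected h] using ih
    · exact coloured_succ_le_cost hadj h

theorem coloured_add_lt_cost {n : ℕ} {u w : V} (hadj : I.graph.Adj u w)
    (h : ¬ I.Connected (I.stage R n) u w) {x : ℝ}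
    (hx : n < I.lastStage R → x < I.moment R (n + 1)) :
    coloured (I.stage R n) s(u, w) + (x - I.moment R n) * I.rate R (I.stage R n) s(u, w) <
      I.cost s(u, w) := by
  by_cases hrate : I.rate R (I.stage R n) s(u, w) = 0
  · simpa [hrate] using coloured_lt_cost hadj h
  · have hlt := hx (lt_lastStage_of_running (running_of_rate_ne_zero hadj h hrate))
    have hle := coloured_succ_le_cost hadj h
    have hpos : (0 : ℝ) < I.rate R (I.stage R n) s(u, w) := by
      exact_mod_cast Nat.pos_of_ne_zero hrate
    rw [coloured_succ] at hle
    nlinarith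

/-! ### The run in real time -/

variable (I R)

/-- The stage that is current at the moment `x`. -/
def stageAt (x : ℝ) : ℕ := Nat.findGreatest (fun n => I.moment R n ≤ x) (I.lastStage R)

/-- The situation at the moment `x`, with growth durations as of the latest event. -/
def stateAt (x : ℝ) : MoatState V := I.stage R (I.stageAt R x)

theorem stageAt_le (x : ℝ) : I.stageAt R x ≤ I.lastStage R := Nat.findGreatest_le _

theorem stageAt_mono : Monotone (I.stageAt R) := fun _ _ h =>
  Nat.findGreatest_mono (fun _ hn => hn.trans h) le_rfl

variable {I R} {x y : ℝ} {n : ℕ}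

theorem moment_stageAt_le (hx : 0 ≤ x) : I.moment R (I.stageAt R x) ≤ x :=
  Nat.findGreatest_spec (P := fun n => I.moment R n ≤ x) (Nat.zero_le _) (by simpa using hx)

theorem lt_moment_succ_stageAt (h : I.stageAt R x < I.lastStage R) :
    x < I.moment R (I.stageAt R x + 1) :=
  not_le.1 (Nat.findGreatest_is_greatest (Nat.lt_succ_self _) h)

theorem le_stageAt (hn : n ≤ I.lastStage R) (h : I.moment R n ≤ x) : n ≤ I.stageAt R x :=
  Nat.le_findGreatest hn h

theorem stageAt_lt (hx : 0 ≤ x) (h : x < I.moment R n) : I.stageAt R x < n := by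
  by_contra! hn
  exact h.not_ge ((I.moment_mono R hn).trans (moment_stageAt_le hx))

theorem stageAt_of_mem_Ico (hn : n < I.lastStage R)
    (hx : x ∈ Set.Ico (I.moment R n) (I.moment R (n + 1))) : I.stageAt R x = n :=
  le_antisymm (Nat.lt_succ_iff.1 (stageAt_lt ((I.moment_nonneg R n).trans hx.1) hx.2))
    (le_stageAt hn.le hx.1)

theorem stageAt_of_moment_lastStage_le (hx : I.moment R (I.lastStage R) ≤ x) :
    I.stageAt R x = I.lastStage R :=
  (I.stageAt_le R x).antisymm (le_stageAt le_rfl hx)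

theorem stageAt_moment (hn : n ≤ I.lastStage R) : I.stageAt R (I.moment R n) = n := by
  rcases hn.eq_or_lt with rfl | hn
  · exact stageAt_of_moment_lastStage_le le_rfl
  · exact stageAt_of_mem_Ico hn ⟨le_rfl, moment_lt_succ hn⟩

theorem Connected.stateAt_mono (hxy : x ≤ y) {u w : V}
    (h : I.Connected (I.stateAt R x) u w) : I.Connected (I.stateAt R y) u w :=
  SimpleGraph.Reachable.mono (I.fullyColoured_stage_mono R (I.stageAt_mono R hxy)) h

variable (I R)

theorem intervalIntegrable_stateAt (g : MoatState V → ℝ) (a b : ℝ) :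
    IntervalIntegrable (fun y => g (I.stateAt R y)) volume a b := by
  have hmeas : Measurable fun y => g (I.stateAt R y) :=
    (measurable_of_countable fun n => g (I.stage R n)).comp (I.stageAt_mono R).measurable
  refine (intervalIntegrable_const (c := ∑ n ∈ Finset.range (I.lastStage R + 1),
    |g (I.stage R n)|)).mono_fun hmeas.aestronglyMeasurable (.of_forall fun y => ?_)
  refine le_trans ?_ (le_abs_self _)
  exact Finset.single_le_sum (f := fun n => |g (I.stage R n)|) (fun n _ => abs_nonneg _)
    (Finset.mem_range.2 (Nat.lt_succ_of_le (I.stageAt_le R y)))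

variable {I R}

theorem integral_stateAt_from_moment (g : MoatState V → ℝ) (hnx : I.moment R n ≤ x)
    (hn : n ≤ I.lastStage R) (hx : n < I.lastStage R → x ≤ I.moment R (n + 1)) :
    ∫ y in I.moment R n..x, g (I.stateAt R y) = (x - I.moment R n) * g (I.stage R n) := by
  rw [intervalIntegral.integral_congr_Ioo_of_le (g := fun _ => g (I.stage R n)) hnx]
  · simp
  · intro y hy
    rcases hn.eq_or_lt with rfl | hn
    · simp only [stateAt, stageAt_of_moment_lastStage_le hy.1.le]
    · simp only [stateAt, stageAt_of_mem_Ico hn ⟨hy.1.le, hy.2.trans_le (hx hn)⟩]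

theorem integral_stateAt_moment (g : MoatState V → ℝ) (hn : n ≤ I.lastStage R) :
    ∫ y in (0 : ℝ)..I.moment R n, g (I.stateAt R y) =
      ∑ k ∈ Finset.range n, (I.moment R (k + 1) - I.moment R k) * g (I.stage R k) := by
  induction n with
  | zero => simp
  | succ n ih =>
    rw [← intervalIntegral.integral_add_adjacent_intervals
      (I.intervalIntegrable_stateAt R g 0 (I.moment R n)) (I.intervalIntegrable_stateAt R g _ _),
      ih (by omega), Finset.sum_range_succ,
      integral_stateAt_from_moment g (I.moment_mono R n.le_succ) (by omega) fun _ => le_rfl]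

theorem integral_stateAt (g : MoatState V → ℝ) (hx : 0 ≤ x) :
    ∫ y in (0 : ℝ)..x, g (I.stateAt R y) =
      ∑ k ∈ Finset.range (I.stageAt R x),
          (I.moment R (k + 1) - I.moment R k) * g (I.stage R k) +
        (x - I.moment R (I.stageAt R x)) * g (I.stateAt R x) := by
  rw [← intervalIntegral.integral_add_adjacent_intervals
    (I.intervalIntegrable_stateAt R g 0 (I.moment R (I.stageAt R x)))
    (I.intervalIntegrable_stateAt R g _ _), integral_stateAt_moment g (I.stageAt_le R x),
    integral_stateAt_from_moment g (moment_stageAt_le hx) (I.stageAt_le R x)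
    fun h => (lt_moment_succ_stageAt h).le, stateAt]

theorem coloured_stage_eq_integral (hn : n ≤ I.lastStage R) (e : Sym2 V) :
    coloured (I.stage R n) e = ∫ y in (0 : ℝ)..I.moment R n, (I.rate R (I.stateAt R y) e : ℝ) := by
  rw [integral_stateAt_moment (fun s => (I.rate R s e : ℝ)) hn, coloured_eq_sum]

theorem integral_rate_eq (hx : 0 ≤ x) (e : Sym2 V) :
    ∫ y in (0 : ℝ)..x, (I.rate R (I.stateAt R y) e : ℝ) = coloured (I.stateAt R x) e +
      (x - I.moment R (I.stageAt R x)) * I.rate R (I.stateAt R x) e := by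
  rw [integral_stateAt (fun s => (I.rate R s e : ℝ)) hx, ← coloured_eq_sum, ← stateAt]

theorem integral_rate_lt_cost {u w : V} (hadj : I.graph.Adj u w) (hx : 0 ≤ x)
    (h : ¬ I.Connected (I.stateAt R x) u w) :
    ∫ y in (0 : ℝ)..x, (I.rate R (I.stateAt R y) s(u, w) : ℝ) < I.cost s(u, w) := by
  rw [integral_rate_eq hx]
  exact coloured_add_lt_cost hadj h lt_moment_succ_stageAt

theorem integral_rate_le_cost {u w : V} (hadj : I.graph.Adj u w) (hx : 0 ≤ x) :
    ∫ y in (0 : ℝ)..x, (I.rate R (I.stateAt R y) s(u, w) : ℝ) ≤ I.cost s(u, w) := by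
  by_cases h : I.Connected (I.stateAt R x) u w
  · rw [integral_rate_eq hx, rate_eq_zero_of_connected h, Nat.cast_zero, mul_zero, add_zero]
    exact coloured_stage_le_cost hadj _
  · exact (integral_rate_lt_cost hadj hx h).le

end Run

/-! ### Distances -/

section Distance

variable {V : Type*} (I : SteinerForest V)

/-- The distance of `u` and `w` with respect to the edge costs is at most `ℓ`. -/
def DistLE (ℓ : ℝ) (u w : V) : Prop := ∃ p : I.graph.Walk u w, (p.edges.map I.cost).sum ≤ ℓ

variable {I} {ℓ ℓ' : ℝ} {u w z : V}

theorem DistLE.refl (u : V) : I.DistLE 0 u u := ⟨.nil, by simp⟩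

theorem DistLE.symm : I.DistLE ℓ u w → I.DistLE ℓ w u := by
  rintro ⟨p, hp⟩
  exact ⟨p.reverse, by simpa using hp⟩

theorem DistLE.trans : I.DistLE ℓ u w → I.DistLE ℓ' w z → I.DistLE (ℓ + ℓ') u z := by
  rintro ⟨p, hp⟩ ⟨q, hq⟩
  exact ⟨p.append q, by simpa using add_le_add hp hq⟩

theorem DistLE.of_adj (h : I.graph.Adj u w) : I.DistLE (I.cost s(u, w)) u w :=
  ⟨h.toWalk, by simp⟩

theorem DistLE.nonneg : I.DistLE ℓ u w → 0 ≤ ℓ := by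
  rintro ⟨p, hp⟩
  refine le_trans (List.sum_nonneg fun x hx => ?_) hp
  obtain ⟨e, he, rfl⟩ := List.mem_map.1 hx
  exact I.cost_nonneg e (p.edges_subset_edgeSet he)

end Distance

section Fingerprint

variable {V : Type*} [Fintype V] {I : SteinerForest V} {R R' : MoatRule V} {ℓ x : ℝ} {u w : V}

theorem integral_rate_le_of_distLE (hx : 0 ≤ x) (h : I.DistLE ℓ u w) :
    ∫ y in (0 : ℝ)..x, (I.rate R (I.stateAt R y) s(u, w) : ℝ) ≤ ℓ := by
  obtain ⟨p, hp⟩ := h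
  refine le_trans ?_ hp
  clear hp
  induction p with
  | nil => simp [rate_eq_zero_of_connected (.refl _)]
  | @cons u z w hadj p ih =>
    have hint : ∀ e, IntervalIntegrable (fun y => (I.rate R (I.stateAt R y) e : ℝ)) volume 0 x :=
      fun e => I.intervalIntegrable_stateAt R (fun s => (I.rate R s e : ℝ)) 0 x
    rw [SimpleGraph.Walk.edges_cons, List.map_cons, List.sum_cons]
    refine le_trans ?_ (add_le_add (integral_rate_le_cost (R := R) hadj hx) ih)
    rw [← intervalIntegral.integral_add (hint _) (hint _)]
    refine intervalIntegral.integral_mono_on hx (hint _) ((hint _).add (hint _)) fun y _ => ?_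
    exact_mod_cast rate_triangle u z w

theorem two_mul_le_of_not_connected (hx : 0 ≤ x)
    (hu : ∀ y, 0 ≤ y → y < x → I.IsActive R (I.stateAt R y) u)
    (hw : ∀ y, 0 ≤ y → y < x → I.IsActive R (I.stateAt R y) w)
    (h : ¬ I.Connected (I.stateAt R x) u w) (hd : I.DistLE ℓ u w) : 2 * x ≤ ℓ :=
  calc 2 * x = ∫ _ in (0 : ℝ)..x, (2 : ℝ) := by simp [mul_comm]
    _ ≤ ∫ y in (0 : ℝ)..x, (I.rate R (I.stateAt R y) s(u, w) : ℝ) := by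
      refine intervalIntegral.integral_mono_on_of_le_Ioo hx intervalIntegrable_const
        (I.intervalIntegrable_stateAt R (fun s => (I.rate R s s(u, w) : ℝ)) _ _) fun y hy => ?_
      rw [rate_eq_ite_add_ite fun hc => h (hc.stateAt_mono hy.2.le), if_pos (hu y hy.1.le hy.2),
        if_pos (hw y hy.1.le hy.2)]
      norm_num
    _ ≤ ℓ := integral_rate_le_of_distLE hx hd

/-! ### Comparing two processes -/

theorem rate_le_rate {s s' : MoatState V} (h : ¬ I.Connected s' u w)
    (hconn : I.Connected s u w → I.Connected s' u w)
    (hu : I.IsActive R s u → I.IsActive R' s' u) (hw : I.IsActive R s w → I.IsActive R' s' w) :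
    I.rate R s s(u, w) ≤ I.rate R' s' s(u, w) := by
  rw [rate_eq_ite_add_ite h, rate_eq_ite_add_ite (mt hconn h)]
  split_ifs <;> first | omega | tauto

theorem connected_stateAt_moment_of_forall_lt {n : ℕ} (hn : n ≤ I.lastStage R)
    (hconn : ∀ y, 0 ≤ y → y < I.moment R n → ∀ u w, I.Connected (I.stateAt R y) u w →
      I.Connected (I.stateAt R' y) u w)
    (hact : ∀ y, 0 ≤ y → y < I.moment R n → ∀ u, I.IsActive R (I.stateAt R y) u →
      I.IsActive R' (I.stateAt R' y) u)
    (h : I.Connected (I.stage R n) u w) : I.Connected (I.stateAt R' (I.moment R n)) u w := by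
  have hedge : ∀ u w, (I.fullyColoured (I.stage R n)).Adj u w →
      I.Connected (I.stateAt R' (I.moment R n)) u w := by
    rintro u w ⟨hadj, hfull⟩
    by_contra hnc
    refine (integral_rate_lt_cost hadj (I.moment_nonneg R n) hnc).not_ge (hfull.trans ?_)
    rw [coloured_stage_eq_integral hn]
    refine intervalIntegral.integral_mono_on_of_le_Ioo (I.moment_nonneg R n)
      (I.intervalIntegrable_stateAt R (fun s => (I.rate R s s(u, w) : ℝ)) _ _)
      (I.intervalIntegrable_stateAt R' (fun s => (I.rate R' s s(u, w) : ℝ)) _ _) fun y hy => ?_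
    exact_mod_cast rate_le_rate (fun hc => hnc (hc.stateAt_mono hy.2.le))
      (hconn y hy.1.le hy.2 u w) (hact y hy.1.le hy.2 u) (hact y hy.1.le hy.2 w)
  obtain ⟨p⟩ := h
  induction p with
  | nil => exact .refl _
  | cons h _ ih => exact (hedge _ _ h).trans ih

/-- In the process `R` a component is active as long as it contains a vertex whose fingerprint has
not been reached; the fingerprint `⊤` keeps a component active forever. -/
structure HasFingerprint (R : MoatRule V) (f : V → EReal) : Prop where
  active_iff : ∀ τ A, R.active τ A ↔ ∃ z ∈ A, (τ : EReal) < f z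
  mem_alarms : ∀ z (a : ℝ), f z = a → a ∈ R.alarms

variable {f g : V → EReal}

theorem sub_time_mem_waits {s : MoatState V} {a : ℝ} (ha : a ∈ R.alarms) (h : s.time < a) :
    a - s.time ∈ I.waits R s :=
  Finset.mem_union_right _ (Finset.mem_image.2 ⟨a, Finset.mem_filter.2 ⟨ha, h⟩, rfl⟩)

theorem lt_of_mem_alarms {a : ℝ} (ha : a ∈ R.alarms)
    (hact : (I.activeSets R (I.stateAt R x)).Nonempty)
    (h : (I.stateAt R x).time < a) : x < a := by
  have hw : a - (I.stateAt R x).time ∈ I.waits R (I.stateAt R x) := sub_time_mem_waits ha h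
  have hrun : I.Running R (I.stage R (I.stageAt R x)) := ⟨hact, ⟨_, hw⟩⟩
  calc x < I.moment R (I.stageAt R x + 1) := lt_moment_succ_stageAt (lt_lastStage_of_running hrun)
    _ = (I.stateAt R x).time + (I.waits R (I.stateAt R x)).min' hrun.2 := moment_succ hrun
    _ ≤ (I.stateAt R x).time + (a - (I.stateAt R x).time) :=
      add_le_add_right (Finset.min'_le _ _ hw) _
    _ = a := add_sub_cancel _ _

theorem time_stateAt_lt_iff {a : ℝ} (ha : a ∈ R.alarms) (hx : 0 ≤ x)
    (hact : (I.activeSets R (I.stateAt R x)).Nonempty) : (I.stateAt R x).time < a ↔ x < a :=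
  ⟨lt_of_mem_alarms ha hact, (moment_stageAt_le hx).trans_lt⟩

theorem HasFingerprint.lt_of_time_lt (hf : HasFingerprint R f) {z : V}
    (h : ((I.stateAt R x).time : EReal) < f z) : (x : EReal) < f z := by
  induction hz : f z with
  | top => exact EReal.coe_lt_top x
  | bot => exact absurd (hz ▸ h) not_lt_bot
  | coe a =>
    have hact : I.IsActive R (I.stateAt R x) z := mem_activeSets_iff.2
      ⟨⟨z, rfl⟩, (hf.active_iff _ _).2 ⟨z, mem_component_iff.2 (.refl z), h⟩⟩
    rw [hz, EReal.coe_lt_coe_iff] at h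
    exact_mod_cast lt_of_mem_alarms (hf.mem_alarms z a hz) ⟨_, hact⟩ h

theorem HasFingerprint.isActive_stateAt_iff (hf : HasFingerprint R f) (hx : 0 ≤ x) :
    I.IsActive R (I.stateAt R x) u ↔
      ∃ z, I.Connected (I.stateAt R x) u z ∧ (x : EReal) < f z := by
  have hmem : I.IsActive R (I.stateAt R x) u ↔
      ∃ z, I.Connected (I.stateAt R x) u z ∧ ((I.stateAt R x).time : EReal) < f z := by
    simp [IsActive, mem_activeSets_iff, hf.active_iff, mem_component_iff]
  rw [hmem]
  refine exists_congr fun z => and_congr_right fun _ => ⟨hf.lt_of_time_lt, fun h => ?_⟩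
  exact lt_of_le_of_lt (by exact_mod_cast moment_stageAt_le hx) h

theorem HasFingerprint.connected_mono (hf : HasFingerprint R f) (hg : HasFingerprint R' g)
    (hx : 0 ≤ x) (hfg : ∀ z (y : ℝ), 0 ≤ y → y < x → (y : EReal) < f z → (y : EReal) < g z)
    (h : I.Connected (I.stateAt R x) u w) : I.Connected (I.stateAt R' x) u w := by
  induction hn : I.stageAt R x using Nat.strong_induction_on generalizing x u w with
  | _ n ih =>
  have hnx : I.moment R n ≤ x := hn ▸ moment_stageAt_le hx
  have hconn : ∀ y, 0 ≤ y → y < I.moment R n → ∀ u w, I.Connected (I.stateAt R y) u w →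
      I.Connected (I.stateAt R' y) u w := fun y hy hyn u w h =>
    ih _ (stageAt_lt hy hyn) hy (fun z y' h0 hlt => hfg z y' h0 (hlt.trans (hyn.trans_le hnx))) h
      rfl
  rw [stateAt, hn] at h
  refine (connected_stateAt_moment_of_forall_lt (hn ▸ I.stageAt_le R x) hconn
    (fun y hy hyn u hu => ?_) h).stateAt_mono hnx
  obtain ⟨z, huz, hz⟩ := (hf.isActive_stateAt_iff hy).1 hu
  exact (hg.isActive_stateAt_iff hy).2
    ⟨z, hconn y hy hyn u z huz, hfg z y hy (hyn.trans_le hnx) hz⟩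

theorem HasFingerprint.isActive_mono (hf : HasFingerprint R f) (hg : HasFingerprint R' g)
    (hfg : f ≤ g) (hx : 0 ≤ x) (h : I.IsActive R (I.stateAt R x) u) :
    I.IsActive R' (I.stateAt R' x) u := by
  obtain ⟨z, huz, hz⟩ := (hf.isActive_stateAt_iff hx).1 h
  exact (hg.isActive_stateAt_iff hx).2
    ⟨z, hf.connected_mono hg hx (fun z _ _ _ hz => hz.trans_le (hfg z)) huz, hz.trans_le (hfg z)⟩

theorem hasFingerprint_boostedRule (t b : V → ℝ) :
    HasFingerprint (boostedRule t b) fun z => (b z : EReal) where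
  active_iff τ A := by simp [boostedRule]
  mem_alarms z a h := by simp [boostedRule, ← EReal.coe_eq_coe_iff.1 h]

theorem hasFingerprint_foreverRule (b : V → ℝ) (v : V) :
    HasFingerprint (foreverRule b v) fun z => if z = v then ⊤ else (b z : EReal) where
  active_iff τ A := by
    simp only [foreverRule]
    constructor
    · rintro (hv | ⟨u, hu, hτ⟩)
      · exact ⟨v, hv, by simp⟩
      · refine ⟨u, hu, ?_⟩
        split_ifs
        · exact EReal.coe_lt_top τ
        · exact_mod_cast hτ
    · rintro ⟨u, hu, hτ⟩
      split_ifs at hτ with huv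
      · exact .inl (huv ▸ hu)
      · exact .inr ⟨u, hu, by exact_mod_cast hτ⟩
  mem_alarms z a h := by
    split_ifs at h
    · exact absurd h (EReal.top_ne_coe a)
    · simp [foreverRule, ← EReal.coe_eq_coe_iff.1 h]

end Fingerprint

/-! ### The potential of the local search -/

theorem sum_add_card_sub_one_le {ι κ : Type*} [DecidableEq ι] {s X : Finset ι} {s' : Finset κ}
    {ρ : κ → ι} {w : ι → ℝ} {w' : κ → ℝ} (hρs : ∀ c ∈ s', ρ c ∈ s) (hinj : Set.InjOn ρ s')
    (hw' : ∀ c ∈ s', w' c ≤ w (ρ c)) (hw : ∀ a ∈ s, 1 ≤ w a) (hXs : X ⊆ s)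
    (hX : (X ∩ s'.image ρ).card ≤ 1) :
    ∑ c ∈ s', w' c + ((X.card - 1 : ℕ) : ℝ) ≤ ∑ a ∈ s, w a := by
  have hcard : X.card - 1 ≤ (X \ s'.image ρ).card := by
    have := Finset.card_sdiff_add_card_inter X (s'.image ρ)
    omega
  have hsub : X \ s'.image ρ ⊆ s \ s'.image ρ := Finset.sdiff_subset_sdiff hXs subset_rfl
  have hone : ∀ a ∈ s \ s'.image ρ, 1 ≤ w a := fun a ha => hw a (Finset.sdiff_subset ha)
  calc ∑ c ∈ s', w' c + ((X.card - 1 : ℕ) : ℝ)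
      ≤ ∑ c ∈ s', w (ρ c) + (X \ s'.image ρ).card :=
        add_le_add (Finset.sum_le_sum hw') (by exact_mod_cast hcard)
    _ ≤ ∑ a ∈ s'.image ρ, w a + ∑ a ∈ X \ s'.image ρ, w a := by
        rw [Finset.sum_image hinj]
        refine add_le_add_right ?_ _
        simpa using Finset.card_nsmul_le_sum _ w 1 fun a ha => hone a (hsub ha)
    _ ≤ ∑ a ∈ s'.image ρ, w a + ∑ a ∈ s \ s'.image ρ, w a :=
        add_le_add_right (Finset.sum_le_sum_of_subset_of_nonneg hsub
          fun a ha _ => zero_le_one.trans (hone a ha)) _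
    _ = ∑ a ∈ s, w a := by
        rw [add_comm, Finset.sum_sdiff (Finset.image_subset_iff.2 hρs)]

/-- The factor with which growth of the active set `A` at the moment `τ` counts in
`y_base + (1 + β) * y_boost`. -/
def boostWeight {V : Type*} (β : ℝ) (t : V → ℝ) (τ : ℝ) (A : Finset V) : ℝ :=
  if ∃ z ∈ A, τ < t z then 1 else 1 + β

section BoostWeight

variable {V : Type*} {β τ : ℝ} {t : V → ℝ} {A C : Finset V}

theorem one_le_boostWeight (hβ : 0 ≤ β) : 1 ≤ boostWeight β t τ A := by
  unfold boostWeight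
  split_ifs <;> linarith

theorem boostWeight_le (hβ : 0 ≤ β) : boostWeight β t τ A ≤ 1 + β := by
  unfold boostWeight
  split_ifs <;> linarith

theorem boostWeight_anti (hβ : 0 ≤ β) (h : A ⊆ C) : boostWeight β t τ C ≤ boostWeight β t τ A := by
  by_cases hA : ∃ z ∈ A, τ < t z
  · obtain ⟨z, hz, hτ⟩ := hA
    rw [boostWeight, if_pos ⟨z, h hz, hτ⟩]
    exact one_le_boostWeight hβ
  · rw [boostWeight.eq_def β t τ A, if_neg hA]
    exact boostWeight_le hβ

end BoostWeight

section Potential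

variable {V : Type*} [Fintype V] (I : SteinerForest V) (R : MoatRule V)

/-- The rate of change of `y_base + (1 + β) * y_boost` at the moment `y`. -/
def potential (β : ℝ) (t : V → ℝ) (y : ℝ) : ℝ :=
  ∑ A ∈ I.activeSets R (I.stateAt R y), boostWeight β t y A

variable {I R} {t b : V → ℝ}

theorem potential_eq_sum_boostWeight_time (ht : ∀ z, t z ∈ R.alarms) (β : ℝ) {y : ℝ} (hy : 0 ≤ y) :
    I.potential R β t y =
      ∑ A ∈ I.activeSets R (I.stateAt R y), boostWeight β t (I.stateAt R y).time A := by
  refine Finset.sum_congr rfl fun A hA => ?_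
  simp only [boostWeight, time_stateAt_lt_iff (ht _) hy ⟨A, hA⟩]

theorem mem_boostedRule_alarms (z : V) : t z ∈ (boostedRule t b).alarms := by simp [boostedRule]

theorem intervalIntegrable_potential (ht : ∀ z, t z ∈ R.alarms) (β : ℝ) {a c : ℝ} (ha : 0 ≤ a)
    (hac : a ≤ c) : IntervalIntegrable (I.potential R β t) volume a c := by
  refine (I.intervalIntegrable_stateAt R
    (fun s => ∑ A ∈ I.activeSets R s, boostWeight β t s.time A) a c).congr fun y hy => ?_
  rw [Set.uIoc_of_le hac] at hy
  exact (potential_eq_sum_boostWeight_time ht β (ha.trans hy.1.le)).symm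

theorem activeSets_lastStage_boostedRule (t b : V → ℝ) :
    I.activeSets (boostedRule t b) (I.stage (boostedRule t b) (I.lastStage (boostedRule t b))) =
      ∅ := by
  by_contra! hne
  have ⟨A, hA⟩ := hne
  obtain ⟨-, z, -, hz⟩ := mem_activeSets_iff.1 hA
  exact not_running_lastStage
    ⟨hne, ⟨_, sub_time_mem_waits ((hasFingerprint_boostedRule t b).mem_alarms z _ rfl) hz⟩⟩

theorem yBase_add_mul_yBoost (β : ℝ) (t b : V → ℝ) {H : ℝ}
    (hH : I.moment (boostedRule t b) (I.lastStage (boostedRule t b)) ≤ H) :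
    I.yBase t b + (1 + β) * I.yBoost t b =
      ∫ y in (0 : ℝ)..H, I.potential (boostedRule t b) β t y := by
  set R := boostedRule t b
  have hH0 : 0 ≤ H := (I.moment_nonneg R _).trans hH
  rw [intervalIntegral.integral_congr_Ioo_of_le (g := fun y =>
    ∑ A ∈ I.activeSets R (I.stateAt R y), boostWeight β t (I.stateAt R y).time A) hH0
    fun y hy => potential_eq_sum_boostWeight_time mem_boostedRule_alarms β hy.1.le,
    integral_stateAt (fun s => ∑ A ∈ I.activeSets R s, boostWeight β t s.time A) hH0,
    stateAt, stageAt_of_moment_lastStage_le hH, activeSets_lastStage_boostedRule,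
    Finset.sum_empty, mul_zero, add_zero, yBase, yBoost, Finset.mul_sum,
    ← Finset.sum_add_distrib]
  refine Finset.sum_congr rfl fun n _ => ?_
  rw [Finset.sum_filter, Finset.sum_filter, Finset.mul_sum, ← Finset.sum_add_distrib,
    Finset.mul_sum]
  refine Finset.sum_congr rfl fun A _ => ?_
  simp only [boostWeight, moment, R]
  split_ifs <;> ring

variable (I)

/-- The number of components that contain a vertex of `X`. -/
def touched (s : MoatState V) (X : Finset V) : ℕ := (X.image (I.component s)).card

variable {I} {s : MoatState V} {X Y : Finset V}

theorem touched_le_one (h : ∀ u ∈ X, ∀ w ∈ X, I.Connected s u w) : I.touched s X ≤ 1 := by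
  rw [touched, Finset.card_le_one]
  simp only [Finset.mem_image]
  rintro _ ⟨u, hu, rfl⟩ _ ⟨w, hw, rfl⟩
  exact component_eq_iff_connected.2 (h u hu w hw)

theorem touched_union_le_add_touched : I.touched s (X ∪ Y) ≤ I.touched s X + I.touched s Y := by
  rw [touched, Finset.image_union]
  exact Finset.card_union_le _ _

theorem touched_le_card : I.touched s X ≤ X.card := Finset.card_image_le

end Potential

section Boost

variable {V : Type*} [Fintype V] {I : SteinerForest V} {R R' : MoatRule V} {f g : V → EReal}
  {β y : ℝ} {t : V → ℝ} {v : V} {C Q : Finset V}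

/-! ### How a boost changes the potential -/

theorem exists_lt_of_mem_activeSets (hg : HasFingerprint R' g) (hgf : ∀ z, z ≠ v → g z ≤ f z)
    (hy : 0 ≤ y) (hC : C ∈ I.activeSets R' (I.stateAt R' y))
    (hv : v ∈ C → (y : EReal) < g v → ∃ z ∈ C, (y : EReal) < f z) :
    ∃ z ∈ C, (y : EReal) < f z := by
  obtain ⟨⟨u, rfl⟩, -⟩ := mem_activeSets_iff.1 hC
  obtain ⟨z, huz, hz⟩ := (hg.isActive_stateAt_iff hy).1 hC
  by_cases hzv : z = v
  · exact hv (hzv ▸ mem_component_iff.2 huz) (hzv ▸ hz)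
  · exact ⟨z, mem_component_iff.2 huz, hz.trans_le (hgf z hzv)⟩

theorem HasFingerprint.exists_activeSet_subset (hf : HasFingerprint R f) (hg : HasFingerprint R' g)
    (hfg : f ≤ g) (hy : 0 ≤ y) (hC : C ∈ I.activeSets R' (I.stateAt R' y))
    (h : ∃ z ∈ C, (y : EReal) < f z) : ∃ A ∈ I.activeSets R (I.stateAt R y), A ⊆ C := by
  obtain ⟨z, hz, hyz⟩ := h
  refine ⟨I.component (I.stateAt R y) z, (hf.isActive_stateAt_iff hy).2 ⟨z, .refl z, hyz⟩,
    fun w hw => ?_⟩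
  rw [← component_of_mem_activeSets hC hz]
  exact mem_component_iff.2 (hf.connected_mono hg hy (fun z _ _ _ hz => hz.trans_le (hfg z))
    (mem_component_iff.1 hw))

theorem HasFingerprint.sum_boostWeight_add_touched_sub_one_le (hf : HasFingerprint R f)
    (hg : HasFingerprint R' g) (hfg : f ≤ g) (hβ : 0 ≤ β) (hy : 0 ≤ y)
    (hact : ∀ q ∈ Q, I.IsActive R (I.stateAt R y) q)
    (hconn : ∀ q ∈ Q, I.Connected (I.stateAt R' y) v q) :
    ∑ C ∈ I.activeSets R' (I.stateAt R' y) with ∃ z ∈ C, (y : EReal) < f z, boostWeight β t y C +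
      ((I.touched (I.stateAt R y) Q - 1 : ℕ) : ℝ) ≤ I.potential R β t y := by
  set s' := {C ∈ I.activeSets R' (I.stateAt R' y) | ∃ z ∈ C, (y : EReal) < f z}
  have hsub : ∀ C ∈ s', ∃ A ∈ I.activeSets R (I.stateAt R y), A ⊆ C := fun C hC =>
    hf.exists_activeSet_subset hg hfg hy (Finset.mem_filter.1 hC).1 (Finset.mem_filter.1 hC).2
  choose! ρ hρ hρsub using hsub
  have hcomp : ∀ C ∈ s', ∀ u ∈ ρ C, I.component (I.stateAt R' y) u = C := fun C hC u hu =>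
    component_of_mem_activeSets (Finset.mem_filter.1 hC).1 (hρsub C hC hu)
  refine sum_add_card_sub_one_le hρ (fun C hC C' hC' heq => ?_)
    (fun C hC => boostWeight_anti hβ (hρsub C hC)) (fun A _ => one_le_boostWeight hβ)
    (Finset.image_subset_iff.2 hact) (Finset.card_le_one_iff_subset_singleton.2
      ⟨ρ (I.component (I.stateAt R' y) v), fun A hA => ?_⟩)
  · obtain ⟨⟨u, hu⟩, -⟩ := mem_activeSets_iff.1 (hρ C hC)
    have hmem : u ∈ ρ C := hu ▸ mem_component_iff.2 (.refl u)
    rw [← hcomp C hC u hmem, hcomp C' hC' u (heq ▸ hmem)]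
  · obtain ⟨hAQ, hAρ⟩ := Finset.mem_inter.1 hA
    obtain ⟨C, hC, rfl⟩ := Finset.mem_image.1 hAρ
    obtain ⟨q, hq, hqC⟩ := Finset.mem_image.1 hAQ
    rw [Finset.mem_singleton, component_eq_iff_connected.2 (hconn q hq),
      hcomp C hC q (hqC ▸ mem_component_iff.2 (.refl q))]

theorem HasFingerprint.potential_le_add (hf : HasFingerprint R f) (hg : HasFingerprint R' g)
    (hfg : f ≤ g) (hgf : ∀ z, z ≠ v → g z ≤ f z) (hβ : 0 ≤ β) (hy : 0 ≤ y) :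
    I.potential R' β t y ≤ I.potential R β t y + (1 + β) := by
  have hold := hf.sum_boostWeight_add_touched_sub_one_le (I := I) (t := t) (v := v) (Q := ∅) hg hfg
    hβ hy (by simp) (by simp)
  have hnew : ({C ∈ I.activeSets R' (I.stateAt R' y) | ¬ ∃ z ∈ C, (y : EReal) < f z}).card ≤ 1 := by
    refine Finset.card_le_one_iff_subset_singleton.2
      ⟨I.component (I.stateAt R' y) v, fun C hC => ?_⟩
    obtain ⟨hC, hnot⟩ := Finset.mem_filter.1 hC
    by_contra hne
    refine hnot (exists_lt_of_mem_activeSets hg hgf hy hC fun hv => absurd ?_ hne)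
    exact Finset.mem_singleton.2 (component_of_mem_activeSets hC hv).symm
  have hsum := Finset.sum_le_card_nsmul _ (boostWeight β t y) (1 + β) fun C (_ : C ∈
    {C ∈ I.activeSets R' (I.stateAt R' y) | ¬ ∃ z ∈ C, (y : EReal) < f z}) => boostWeight_le hβ
  rw [potential, ← Finset.sum_filter_add_sum_filter_not _ fun C => ∃ z ∈ C, (y : EReal) < f z]
  refine add_le_add ((le_add_of_nonneg_right (Nat.cast_nonneg _)).trans hold) (hsum.trans ?_)
  rw [nsmul_eq_mul]
  exact mul_le_of_le_one_left (by linarith) (by exact_mod_cast hnew)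

theorem HasFingerprint.potential_add_touched_sub_one_le (hf : HasFingerprint R f)
    (hg : HasFingerprint R' g) (hfg : f ≤ g) (hgf : ∀ z, z ≠ v → g z ≤ f z) (hβ : 0 ≤ β)
    (hy : 0 ≤ y) (hQ : Q.Nonempty) (hact : ∀ q ∈ Q, I.IsActive R (I.stateAt R y) q)
    (hconn : ∀ q ∈ Q, I.Connected (I.stateAt R' y) v q) :
    I.potential R' β t y + (I.touched (I.stateAt R y) Q - 1) ≤ I.potential R β t y := by
  have hall : ∀ C ∈ I.activeSets R' (I.stateAt R' y), ∃ z ∈ C, (y : EReal) < f z := by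
    refine fun C hC => exists_lt_of_mem_activeSets hg hgf hy hC fun hv _ => ?_
    obtain ⟨q, hq⟩ := hQ
    obtain ⟨z, hqz, hz⟩ := (hf.isActive_stateAt_iff hy).1 (hact q hq)
    refine ⟨z, ?_, hz⟩
    rw [← component_of_mem_activeSets hC hv]
    exact mem_component_iff.2 ((hconn q hq).trans
      (hf.connected_mono hg hy (fun z _ _ _ hz => hz.trans_le (hfg z)) hqz))
  have hone : 1 ≤ I.touched (I.stateAt R y) Q := Finset.card_pos.2 (hQ.image _)
  have key := hf.sum_boostWeight_add_touched_sub_one_le (t := t) hg hfg hβ hy hact hconn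
  rwa [Finset.filter_true_of_mem hall, Nat.cast_sub hone, Nat.cast_one] at key

theorem HasFingerprint.potential_le (hf : HasFingerprint R f) (hg : HasFingerprint R' g)
    (hfg : f ≤ g) (hgf : ∀ z, z ≠ v → g z ≤ f z) (hβ : 0 ≤ β) (hy : 0 ≤ y) (hgv : g v ≤ y) :
    I.potential R' β t y ≤ I.potential R β t y := by
  have hall : ∀ C ∈ I.activeSets R' (I.stateAt R' y), ∃ z ∈ C, (y : EReal) < f z := fun C hC =>
    exists_lt_of_mem_activeSets hg hgf hy hC fun _ hlt => absurd hlt hgv.not_gt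
  have key := hf.sum_boostWeight_add_touched_sub_one_le (I := I) (t := t) (v := v) (Q := ∅) hg hfg
    hβ hy (by simp) (by simp)
  rw [Finset.filter_true_of_mem hall] at key
  exact (le_add_of_nonneg_right (Nat.cast_nonneg _)).trans key

end Boost

/-! ### Stars -/

theorem intervalIntegrable_ite_le (x a c : ℝ) :
    IntervalIntegrable (fun y : ℝ => if y ≤ x then (1 : ℝ) else 0) volume a c := by
  refine Antitone.intervalIntegrable fun y z hyz => ?_
  split_ifs with hz hy
  exacts [le_rfl, absurd (hyz.trans hz) hy, zero_le_one, le_rfl]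

theorem integral_ite_le_le {x H : ℝ} (hx : 0 ≤ x) (hH : 0 ≤ H) :
    ∫ y in (0 : ℝ)..H, (if y ≤ x then (1 : ℝ) else 0) ≤ x := by
  have heq : (∫ y in (0 : ℝ)..H, if y ≤ x then (1 : ℝ) else 0) =
      volume.real (Set.Ioc 0 H ∩ Set.Iic x) := by
    rw [intervalIntegral.integral_of_le hH]
    change ∫ y in Set.Ioc 0 H, (Set.Iic x).indicator (fun _ => (1 : ℝ)) y = _
    rw [setIntegral_indicator measurableSet_Iic, setIntegral_const, smul_eq_mul, mul_one]
  rw [heq, Set.Ioc_inter_Iic, Real.volume_real_Ioc_of_le (le_min hH hx), sub_zero]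
  exact min_le_right _ _

section Excess

variable {V : Type*} [Fintype V] (I : SteinerForest V) (R : MoatRule V)

/-- The integral over the moments up to `H` of the number of merges that are still missing to
connect all vertices of `X`. -/
def excess (H : ℝ) (X : Finset V) : ℝ :=
  ∫ y in (0 : ℝ)..H, ((I.touched (I.stateAt R y) X : ℝ) - 1)

theorem intervalIntegrable_touched_sub_one (X : Finset V) (a c : ℝ) :
    IntervalIntegrable (fun y => (I.touched (I.stateAt R y) X : ℝ) - 1) volume a c :=
  I.intervalIntegrable_stateAt R (fun s => (I.touched s X : ℝ) - 1) a c

end Excess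

theorem coe_le_coe_update {V : Type*} {b : V → ℝ} {v : V} {σ : ℝ} (hσ : b v ≤ σ) :
    (fun z => (b z : EReal)) ≤ fun z => (Function.update b v σ z : EReal) := fun z =>
  EReal.coe_le_coe_iff.2 ((le_update_iff.2 ⟨hσ, fun _ _ => le_rfl⟩ : b ≤ Function.update b v σ) z)

theorem coe_le_ite_top {V : Type*} (b : V → ℝ) (v : V) :
    (fun z => (b z : EReal)) ≤ fun z => if z = v then ⊤ else (b z : EReal) := by
  intro z
  dsimp only
  split_ifs
  exacts [le_top, le_rfl]

/-- No boost action of the local search is valuable any more. -/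
def IsLocalOptimum {V : Type*} [Fintype V] (I : SteinerForest V) (β : ℝ) (t b : V → ℝ) : Prop :=
  ∀ v τ, I.IsBoostCandidate b v τ → ¬ I.Valuable β t b v τ

section Star

variable {V ι : Type*} [Fintype V] [Fintype ι] {I : SteinerForest V} {R : MoatRule V}
  {t b : V → ℝ} {β H σ : ℝ} {v : V} {q : ι → V} {a : ι → ℝ} {i₀ : ι}

theorem touched_image_le (s : MoatState V) (q : ι → V) (a : ι → ℝ) (y : ℝ) :
    (I.touched s (Finset.univ.image q) : ℝ) ≤
      I.touched s (({i | a i / 2 < y} : Finset ι).image q) + ∑ i, if y ≤ a i / 2 then 1 else 0 := by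
  have hunion : Finset.univ.image q =
      ({i | a i / 2 < y} : Finset ι).image q ∪ ({i | y ≤ a i / 2} : Finset ι).image q := by
    simp only [← Finset.image_union, ← not_lt, Finset.filter_union_filter_not_eq]
  rw [hunion, Finset.sum_boole]
  exact_mod_cast touched_union_le_add_touched.trans
    (Nat.add_le_add_left (touched_le_card.trans Finset.card_image_le) _)

theorem touched_image_sub_one_le {s : MoatState V} {y : ℝ}
    (h : ∀ i, a i / 2 < y → I.Connected s v (q i)) :
    (I.touched s (Finset.univ.image q) : ℝ) - 1 ≤ ∑ i, if y ≤ a i / 2 then 1 else 0 := by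
  set Q := ({i | a i / 2 < y} : Finset ι).image q
  have hQ : ∀ u ∈ Q, I.Connected s v u :=
    Finset.forall_mem_image.2 fun i hi => h i (Finset.mem_filter.1 hi).2
  have hone : (I.touched s Q : ℝ) ≤ 1 := by
    exact_mod_cast touched_le_one fun u hu w hw => (hQ u hu).symm.trans (hQ w hw)
  linarith [touched_image_le (I := I) s q a y]

theorem intervalIntegrable_sum_ite_le (a : ι → ℝ) (c d : ℝ) :
    IntervalIntegrable (fun y => ∑ i, if y ≤ a i / 2 then (1 : ℝ) else 0) volume c d := by
  simpa only [Finset.sum_fn] using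
    IntervalIntegrable.sum Finset.univ fun i _ => intervalIntegrable_ite_le (a i / 2) c d

theorem integral_sum_ite_le_le (hH : 0 ≤ H) (ha : ∀ i, 0 ≤ a i) :
    ∫ y in (0 : ℝ)..H, ∑ i, (if y ≤ a i / 2 then (1 : ℝ) else 0) ≤ (∑ i, a i) / 2 := by
  rw [intervalIntegral.integral_finsetSum fun i _ => intervalIntegrable_ite_le _ _ _,
    Finset.sum_div]
  exact Finset.sum_le_sum fun i _ => integral_ite_le_le (by linarith [ha i]) hH

theorem two_mul_excess_le_of_connected (hH : 0 ≤ H) (ha : ∀ i, 0 ≤ a i)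
    (h : ∀ y, 0 ≤ y → y < H → ∀ i, a i / 2 < y → I.Connected (I.stateAt R y) v (q i)) :
    2 * I.excess R H (Finset.univ.image q) ≤ ∑ i, a i := by
  have hle : I.excess R H (Finset.univ.image q) ≤ (∑ i, a i) / 2 :=
    (intervalIntegral.integral_mono_on_of_le_Ioo hH (I.intervalIntegrable_touched_sub_one R _ _ _)
      (intervalIntegrable_sum_ite_le a _ _) fun y hy =>
        touched_image_sub_one_le (h y hy.1.le hy.2)).trans (integral_sum_ite_le_le hH ha)
  linarith

theorem potential_update_add_touched_sub_one_le (hβ : 0 ≤ β) (hσ : b v ≤ σ) {y : ℝ} (hy : 0 ≤ y)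
    (i₀ : ι)
    (hact : ∀ i, I.IsActive (boostedRule t b) (I.stateAt (boostedRule t b) y) (q i))
    (hconn : ∀ i, a i / 2 < y → I.Connected (I.stateAt (boostedRule t (Function.update b v σ)) y)
      v (q i)) :
    I.potential (boostedRule t (Function.update b v σ)) β t y +
        (I.touched (I.stateAt (boostedRule t b) y) (Finset.univ.image q) - 1) ≤
      I.potential (boostedRule t b) β t y +
        (∑ i, (if y ≤ a i / 2 then 1 else 0) + β * if y ≤ a i₀ / 2 then 1 else 0) := by
  have hf := hasFingerprint_boostedRule t b
  have hg := hasFingerprint_boostedRule t (Function.update b v σ)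
  have hgf : ∀ z, z ≠ v → (Function.update b v σ z : EReal) ≤ b z := fun z hz => by simp [hz]
  have hsplit := touched_image_le (I := I) (I.stateAt (boostedRule t b) y) q a y
  rcases ({i | a i / 2 < y} : Finset ι).eq_empty_or_nonempty with hempty | hne
  · have hi₀ : y ≤ a i₀ / 2 := by
      simpa using Finset.filter_eq_empty_iff.1 hempty (Finset.mem_univ i₀)
    have hle := hf.potential_le_add (I := I) (t := t) hg (coe_le_coe_update hσ) hgf hβ hy
    simp only [hempty, Finset.image_empty, touched, Finset.card_empty, Nat.cast_zero] at hsplit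
    rw [if_pos hi₀, touched]
    linarith
  · have hle := hf.potential_add_touched_sub_one_le (I := I) (t := t) hg (coe_le_coe_update hσ) hgf
      hβ hy (hne.image q) (Finset.forall_mem_image.2 fun i _ => hact i)
      (Finset.forall_mem_image.2 fun i hi => hconn i (Finset.mem_filter.1 hi).2)
    have hpos : 0 ≤ β * if y ≤ a i₀ / 2 then (1 : ℝ) else 0 := by positivity
    linarith

theorem intervalIntegrable_potential_boostedRule (t b : V → ℝ) (β : ℝ) {c d : ℝ} (hc : 0 ≤ c)
    (hcd : c ≤ d) : IntervalIntegrable (I.potential (boostedRule t b) β t) volume c d :=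
  intervalIntegrable_potential mem_boostedRule_alarms β hc hcd

theorem integral_potential_update_add_excess_le (hβ : 0 ≤ β) (hσ : b v ≤ σ) (hH : 0 ≤ H) (i₀ : ι)
    (ha : ∀ i, 0 ≤ a i)
    (hact : ∀ i y, 0 ≤ y → y < H →
      I.IsActive (boostedRule t b) (I.stateAt (boostedRule t b) y) (q i))
    (hconn : ∀ y, 0 ≤ y → y < H → ∀ i, a i / 2 < y →
      I.Connected (I.stateAt (boostedRule t (Function.update b v σ)) y) v (q i)) :
    (∫ y in (0 : ℝ)..H, I.potential (boostedRule t (Function.update b v σ)) β t y) +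
        I.excess (boostedRule t b) H (Finset.univ.image q) ≤
      (∫ y in (0 : ℝ)..H, I.potential (boostedRule t b) β t y) + (∑ i, a i + β * a i₀) / 2 := by
  have hpot := intervalIntegrable_potential_boostedRule (I := I) t b β le_rfl hH
  have hpot' :=
    intervalIntegrable_potential_boostedRule (I := I) t (Function.update b v σ) β le_rfl hH
  have htouched := I.intervalIntegrable_touched_sub_one (boostedRule t b) (Finset.univ.image q) 0 H
  have hsum := intervalIntegrable_sum_ite_le a 0 H
  have hfirst := (intervalIntegrable_ite_le (a i₀ / 2) 0 H).const_mul β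
  have hle := intervalIntegral.integral_mono_on_of_le_Ioo hH (hpot'.add htouched)
    (hpot.add (hsum.add hfirst)) fun y hy =>
      potential_update_add_touched_sub_one_le hβ hσ hy.1.le i₀ (fun i => hact i y hy.1.le hy.2)
        (hconn y hy.1.le hy.2)
  rw [intervalIntegral.integral_add hpot' htouched,
    intervalIntegral.integral_add hpot (hsum.add hfirst),
    intervalIntegral.integral_add hsum hfirst, intervalIntegral.integral_const_mul,
    ← excess.eq_def] at hle
  have hmul := mul_le_mul_of_nonneg_left
    (integral_ite_le_le (x := a i₀ / 2) (by linarith [ha i₀]) hH) hβ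
  linarith [integral_sum_ite_le_le hH ha]

theorem integral_potential_update_le (hβ : 0 ≤ β) (hσ : b v ≤ σ) (hσH : σ ≤ H) (hH : 0 ≤ H) {L : ℝ}
    (hHL : H ≤ L) :
    ∫ y in H..L, I.potential (boostedRule t (Function.update b v σ)) β t y ≤
      ∫ y in H..L, I.potential (boostedRule t b) β t y :=
  intervalIntegral.integral_mono_on_of_le_Ioo hHL
    (intervalIntegrable_potential_boostedRule (I := I) t _ β hH hHL)
    (intervalIntegrable_potential_boostedRule (I := I) t b β hH hHL) fun y hy =>
      (hasFingerprint_boostedRule t b).potential_le (v := v)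
        (hasFingerprint_boostedRule t (Function.update b v σ)) (coe_le_coe_update hσ)
        (fun z hz => by simp [hz]) hβ (hH.trans hy.1.le) (by simpa using hσH.trans hy.1.le)

theorem yBase_add_mul_yBoost_update_add_excess_le (hβ : 0 ≤ β) (hσ : b v ≤ σ) (hσH : σ ≤ H)
    (hH : 0 ≤ H) (i₀ : ι) (ha : ∀ i, 0 ≤ a i)
    (hact : ∀ i y, 0 ≤ y → y < H →
      I.IsActive (boostedRule t b) (I.stateAt (boostedRule t b) y) (q i))
    (hconn : ∀ y, 0 ≤ y → y < H → ∀ i, a i / 2 < y →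
      I.Connected (I.stateAt (boostedRule t (Function.update b v σ)) y) v (q i)) :
    I.yBase t (Function.update b v σ) + (1 + β) * I.yBoost t (Function.update b v σ) +
        I.excess (boostedRule t b) H (Finset.univ.image q) ≤
      I.yBase t b + (1 + β) * I.yBoost t b + (∑ i, a i + β * a i₀) / 2 := by
  set R := boostedRule t b
  set R' := boostedRule t (Function.update b v σ)
  obtain ⟨L, ⟨hHL, hRL⟩, hRL'⟩ : ∃ L, (H ≤ L ∧ I.moment R (I.lastStage R) ≤ L) ∧
      I.moment R' (I.lastStage R') ≤ L := by
    simp only [← max_le_iff]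
    exact ⟨_, le_rfl⟩
  have hint : ∀ b {c d : ℝ}, 0 ≤ c → c ≤ d →
      IntervalIntegrable (I.potential (boostedRule t b) β t) volume c d := fun b _ _ =>
    intervalIntegrable_potential_boostedRule (I := I) t b β
  rw [yBase_add_mul_yBoost β t b hRL, yBase_add_mul_yBoost β t _ hRL',
    ← intervalIntegral.integral_add_adjacent_intervals (hint _ le_rfl hH) (hint _ hH hHL),
    ← intervalIntegral.integral_add_adjacent_intervals (hint _ le_rfl hH) (hint _ hH hHL)]
  have hearly := integral_potential_update_add_excess_le hβ hσ hH i₀ ha hact hconn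
  have hlate := integral_potential_update_le (I := I) (t := t) hβ hσ hσH hH hHL
  linarith

theorem connected_stateAt_foreverRule (hf : HasFingerprint R fun z => (b z : EReal)) {p : V}
    {d : ℝ} (hact : ∀ y, 0 ≤ y → y < H → I.IsActive R (I.stateAt R y) p) (hd : I.DistLE d v p)
    {y : ℝ} (hy : y ≤ H) (hdy : d / 2 < y) :
    I.Connected (I.stateAt (foreverRule b v) y) v p := by
  have hF := hasFingerprint_foreverRule b v
  by_contra hcon
  have h2 := two_mul_le_of_not_connected (by linarith [hd.nonneg])
    (fun x hx _ => (hF.isActive_stateAt_iff hx).2 ⟨v, .refl v, by simp⟩)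
    (fun x hx hxy => hf.isActive_mono hF (coe_le_ite_top b v) hx (hact x hx (hxy.trans_le hy)))
    hcon hd
  linarith

theorem connected_stateAt_of_foreverRule {R' : MoatRule V} {g : V → EReal} {p : V}
    (hg : HasFingerprint R' g) (hbg : ∀ z, (b z : EReal) ≤ g z)
    (hgv : ∀ y : ℝ, 0 ≤ y → y < σ → (y : EReal) < g v) {x : ℝ} (hx : 0 ≤ x) (hxσ : x ≤ σ)
    (h : I.Connected (I.stateAt (foreverRule b v) x) v p) : I.Connected (I.stateAt R' x) v p := by
  refine (hasFingerprint_foreverRule b v).connected_mono hg hx (fun z y hy0 hyx hyz => ?_) h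
  by_cases hzv : z = v
  · exact hzv ▸ hgv y hy0 (hyx.trans_le hxσ)
  · exact ((if_neg hzv).subst hyz).trans_le (hbg z)

theorem isBoostCandidate_of_not_connected {n : ℕ} {p : V}
    (hbv : b v < I.moment (foreverRule b v) (n + 1))
    (hact : I.IsActive (foreverRule b v) (I.stage (foreverRule b v) n) p)
    (hnot : ¬ I.Connected (I.stage (foreverRule b v) n) v p)
    (hconn : I.Connected (I.stage (foreverRule b v) (n + 1)) v p) :
    I.IsBoostCandidate b v (I.moment (foreverRule b v) (n + 1)) := by
  refine ⟨hbv, n, rfl, _, hact, fun h => hnot (component_eq_iff_connected.1 h).symm,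
    fun w hw => mem_component_iff.2 (hconn.trans ?_)⟩
  exact SimpleGraph.Reachable.mono (I.fullyColoured_stage_mono _ n.le_succ) (mem_component_iff.1 hw)

theorem exists_merge_moment {ι : Type*} {q : ι → V} {a : ι → ℝ}
    (hf : HasFingerprint R fun z => (b z : EReal)) (hH : 0 ≤ H)
    (hact : ∀ i y, 0 ≤ y → y < H → I.IsActive R (I.stateAt R y) (q i))
    (hd : ∀ i, I.DistLE (a i) v (q i)) :
    ∃ σ, 0 ≤ σ ∧ σ ≤ H ∧ (0 < σ → b v < σ → I.IsBoostCandidate b v σ) ∧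
      ∀ i, a i / 2 < H → I.Connected (I.stateAt (foreverRule b v) σ) v (q i) := by
  set F := foreverRule b v
  have hH_conn : ∀ i, a i / 2 < H → I.Connected (I.stage F (I.stageAt F H)) v (q i) := fun i hi =>
    connected_stateAt_foreverRule hf (hact i) (hd i) le_rfl hi
  have hex : ∃ n, ∀ i, a i / 2 < H → I.Connected (I.stage F n) v (q i) := ⟨_, hH_conn⟩
  have hle : Nat.find hex ≤ I.stageAt F H := Nat.find_min' hex hH_conn
  have hspec := Nat.find_spec hex
  have hmin := fun m => Nat.find_min hex (m := m)
  generalize Nat.find hex = n at hle hspec hmin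
  have hnH : I.moment F n ≤ H := (I.moment_mono F hle).trans (moment_stageAt_le hH)
  have hnL : n ≤ I.lastStage F := hle.trans (I.stageAt_le F H)
  refine ⟨I.moment F n, I.moment_nonneg F n, hnH, fun hpos hbv => ?_, fun i hi => ?_⟩
  · obtain _ | m := n
    · exact absurd hpos (I.moment_zero F).not_gt
    have hmn := moment_lt_succ (Nat.lt_of_succ_le hnL)
    obtain ⟨i, hiH, hnot⟩ : ∃ i, a i / 2 < H ∧ ¬ I.Connected (I.stage F m) v (q i) := by
      simpa only [not_forall, exists_prop] using hmin m m.lt_succ_self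
    have hact' := hf.isActive_mono (hasFingerprint_foreverRule b v) (coe_le_ite_top b v)
      (I.moment_nonneg F m) (hact i _ (I.moment_nonneg F m) (hmn.trans_le hnH))
    rw [stateAt, stageAt_moment (Nat.le_of_succ_le hnL)] at hact'
    exact isBoostCandidate_of_not_connected hbv hact' hnot (hspec i hiH)
  · rw [stateAt, stageAt_moment hnL]
    exact hspec i hi

theorem connected_stateAt_of_merge_moment {R' : MoatRule V} {g : V → EReal} {p : V} {d y : ℝ}
    (hf : HasFingerprint R fun z => (b z : EReal))
    (hact : ∀ y, 0 ≤ y → y < H → I.IsActive R (I.stateAt R y) p) (hd : I.DistLE d v p)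
    (hσ0 : 0 ≤ σ) (hσ : d / 2 < H → I.Connected (I.stateAt (foreverRule b v) σ) v p)
    (hg : HasFingerprint R' g) (hbg : ∀ z, (b z : EReal) ≤ g z)
    (hgv : ∀ y : ℝ, 0 ≤ y → y < σ → (y : EReal) < g v) (hy : 0 ≤ y) (hyH : y < H)
    (hdy : d / 2 < y) : I.Connected (I.stateAt R' y) v p := by
  rcases le_total y σ with hyσ | hσy
  · exact connected_stateAt_of_foreverRule hg hbg hgv hy hyσ
      (connected_stateAt_foreverRule hf hact hd hyH.le hdy)
  · exact (connected_stateAt_of_foreverRule hg hbg hgv hσ0 le_rfl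
      (hσ (hdy.trans hyH))).stateAt_mono hσy

/-- If `v` stayed active forever, then every `q i` with `a i / 2 < H` would be connected to `v` from
the moment `a i / 2` on, so boosting `v` to the moment `σ` of the last of these merges has a win
that is too small only if the `q i` merge early anyway. -/
theorem two_mul_excess_star_le (hβ : 0 ≤ β) (hb : I.IsLocalOptimum β t b) (hH : 0 ≤ H)
    (hact : ∀ i y, 0 ≤ y → y < H →
      I.IsActive (boostedRule t b) (I.stateAt (boostedRule t b) y) (q i))
    (hd : ∀ i, I.DistLE (a i) v (q i)) (i₀ : ι) :
    2 * I.excess (boostedRule t b) H (Finset.univ.image q) ≤ ∑ i, a i + β * a i₀ := by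
  have hf := hasFingerprint_boostedRule t b
  have ha : ∀ i, 0 ≤ a i := fun i => (hd i).nonneg
  obtain ⟨σ, hσ0, hσH, hcand, hconn⟩ := exists_merge_moment hf hH hact hd
  by_cases hσ : 0 < σ ∧ b v < σ
  · have hloss : ¬ I.Valuable β t b v σ := hb v σ (hcand hσ.1 hσ.2)
    have hle := yBase_add_mul_yBoost_update_add_excess_le hβ hσ.2.le hσH hH i₀ ha hact
      fun y hy hyH i hiy =>
        connected_stateAt_of_merge_moment hf (hact i) (hd i) hσ0 (hconn i)
          (hasFingerprint_boostedRule t (Function.update b v σ)) (coe_le_coe_update hσ.2.le)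
          (fun z _ hz => by simpa using hz) hy hyH hiy
    rw [Valuable, win, loss, not_le] at hloss
    linarith
  · have hle := two_mul_excess_le_of_connected (a := a) hH ha fun y hy hyH i hiy =>
      connected_stateAt_of_merge_moment hf (hact i) (hd i) hσ0 (hconn i) hf (fun _ => le_rfl)
        (fun z hz hzσ => EReal.coe_lt_coe_iff.2
          (hzσ.trans_le (not_lt.1 fun h => hσ ⟨hz.trans_lt hzσ, h⟩))) hy hyH hiy
    exact hle.trans (le_add_of_nonneg_right (mul_nonneg hβ (ha i₀)))

end Star

/-! ### Decomposing trees into stars -/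

section Decomposition

variable {V : Type*} {I : SteinerForest V} {S X Y : Finset V} {β c c' : ℝ} {J : Finset V → ℝ}
  {x : V}

/-- The properties of `excess` that the decomposition of a tree uses: connecting `A` and `B`
separately suffices to connect `A ∪ B` if they share a vertex, and the terminals of a star merge
early. As any leg can take the role of the first one, the extra term is `β` times the length of the
shortest leg. -/
structure IsStarBounded (I : SteinerForest V) (S : Finset V) (β : ℝ) (J : Finset V → ℝ) :
    Prop where
  singleton : ∀ u ∈ S, J {u} = 0
  union : ∀ A B, (A ∩ B).Nonempty → J (A ∪ B) ≤ J A + J B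
  star : ∀ v, ∀ q₁ ∈ S, ∀ q₂ ∈ S, ∀ q₃ ∈ S, ∀ a₁ a₂ a₃, I.DistLE a₁ v q₁ → I.DistLE a₂ v q₂ →
    I.DistLE a₃ v q₃ → 2 * J {q₁, q₂, q₃} ≤ a₁ + a₂ + a₃ + β * a₁

/-- The terminals `X` are spanned by a tree of cost `c` with root `v`. The tree splits at `v` into
two parts, with terminals `X₁` and `X₂`, that have terminals at distance `a₁` and `a₂` from `v`. The
inequality leaves room for one more way of connecting `X`, namely `X₁` and `X₂` through `v`, which
makes six copies of `J X` altogether, and for the stars that arise when another tree is joined at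
distance at least `a₁`. -/
def SplitsAt (I : SteinerForest V) (β : ℝ) (J : Finset V → ℝ) (v : V) (X : Finset V) (c : ℝ) :
    Prop :=
  ∃ X₁ X₂ q₁ q₂ a₁ a₂, q₁ ∈ X₁ ∧ q₂ ∈ X₂ ∧ X = X₁ ∪ X₂ ∧ I.DistLE a₁ v q₁ ∧ I.DistLE a₂ v q₂ ∧
    2 * (2 * J X + J X₁ + J X₂) + a₁ + a₂ ≤ (5 + β) * c - 2 * (2 + β) * a₁

/-- The terminals `X` are empty or spanned by a tree of cost at most `c` that contains `x`: a path
leads from `x` to the vertex at which the tree splits. -/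
def SpannedFrom (I : SteinerForest V) (S : Finset V) (β : ℝ) (J : Finset V → ℝ) (x : V)
    (X : Finset V) (c : ℝ) : Prop :=
  0 ≤ c ∧ (X.Nonempty → X ⊆ S ∧ ∃ v e c', I.DistLE e x v ∧ SplitsAt I β J v X c' ∧ e + c' ≤ c)

theorem IsStarBounded.le_pair (hJ : IsStarBounded I S β J) {A B : Finset V} {p q : V}
    (hp : p ∈ A) (hq : q ∈ B) : J (A ∪ B) ≤ J {p, q} + J A + J B := by
  have hA := hJ.union {p, q} A ⟨p, by simp [hp]⟩
  have hB := hJ.union ({p, q} ∪ A) B ⟨q, by simp [hq]⟩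
  rw [show {p, q} ∪ A ∪ B = A ∪ B by grind] at hB
  linarith

theorem IsStarBounded.le_triple (hJ : IsStarBounded I S β J) {A B C : Finset V} {p q r : V}
    (hp : p ∈ A) (hq : q ∈ B) (hr : r ∈ C) : J (A ∪ B ∪ C) ≤ J {p, q, r} + J A + J B + J C := by
  have hA := hJ.union {p, q, r} A ⟨p, by simp [hp]⟩
  have hB := hJ.union ({p, q, r} ∪ A) B ⟨q, by simp [hq]⟩
  have hC := hJ.union ({p, q, r} ∪ A ∪ B) C ⟨r, by simp [hr]⟩
  rw [show {p, q, r} ∪ A ∪ B ∪ C = A ∪ B ∪ C by grind] at hC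
  linarith

theorem IsStarBounded.two_mul_pair_le (hJ : IsStarBounded I S β J) {v p q : V} (hp : p ∈ S)
    (hq : q ∈ S) {a a' : ℝ} (d : I.DistLE a v p) (d' : I.DistLE a' v q) :
    2 * J {p, q} ≤ a + a' := by
  have h := hJ.star p p hp p hp q hq 0 0 (a + a') (.refl p) (.refl p) (d.symm.trans d')
  rw [Finset.insert_eq_of_mem (by simp)] at h
  linarith

theorem SplitsAt.join (hJ : IsStarBounded I S β J) (hβ : 0 ≤ β) {v w : V} {e e' : ℝ} (hX : X ⊆ S)
    (hY : Y ⊆ S) (hv : I.DistLE e x v) (hw : I.DistLE e' x w) (h : SplitsAt I β J v X c)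
    (h' : SplitsAt I β J w Y c') : SplitsAt I β J x (X ∪ Y) (e + c + (e' + c')) := by
  obtain ⟨X₁, X₂, q₁, q₂, a₁, a₂, hq₁, hq₂, rfl, hd₁, hd₂, hle⟩ := h
  obtain ⟨Y₁, Y₂, p₁, p₂, b₁, b₂, hp₁, hp₂, rfl, hd₁', hd₂', hle'⟩ := h'
  have hq₁S := hX (Finset.mem_union_left _ hq₁)
  have hp₁S := hY (Finset.mem_union_left _ hp₁)
  have hstar := hJ.star v q₁ hq₁S q₂ (hX (Finset.mem_union_right _ hq₂)) p₁ hp₁S _ _ _ hd₁ hd₂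
    (hv.symm.trans (hw.trans hd₁'))
  have hstar' := hJ.star w p₁ hp₁S p₂ (hY (Finset.mem_union_right _ hp₂)) q₁ hq₁S _ _ _ hd₁' hd₂'
    (hw.symm.trans (hv.trans hd₁))
  have hunion := hJ.le_triple hq₁ hq₂ (Finset.mem_union_left Y₂ hp₁)
  have hunion' := hJ.le_triple hp₁ hp₂ (Finset.mem_union_left X₂ hq₁)
  rw [Finset.union_comm (Y₁ ∪ Y₂)] at hunion'
  rcases le_total (e + a₁) (e' + b₁) with hm | hm
  · refine ⟨X₁ ∪ X₂, Y₁ ∪ Y₂, q₁, p₁, e + a₁, e' + b₁, Finset.mem_union_left _ hq₁,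
      Finset.mem_union_left _ hp₁, rfl, hv.trans hd₁, hw.trans hd₁', ?_⟩
    linarith [mul_le_mul_of_nonneg_left hm (by linarith : 0 ≤ 2 + β)]
  · refine ⟨Y₁ ∪ Y₂, X₁ ∪ X₂, p₁, q₁, e' + b₁, e + a₁, Finset.mem_union_left _ hp₁,
      Finset.mem_union_left _ hq₁, Finset.union_comm _ _, hw.trans hd₁', hv.trans hd₁, ?_⟩
    linarith [mul_le_mul_of_nonneg_left hm (by linarith : 0 ≤ 2 + β)]

theorem SpannedFrom.of_subset_singleton (hJ : IsStarBounded I S β J) (hXS : X ⊆ S)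
    (hX : X ⊆ {x}) : SpannedFrom I S β J x X 0 := by
  refine ⟨le_rfl, fun hne => ?_⟩
  obtain rfl := (Finset.Nonempty.subset_singleton_iff hne).1 hX
  refine ⟨hXS, x, 0, 0, .refl x, ⟨{x}, {x}, x, x, 0, 0, ?_⟩, (add_zero 0).le⟩
  simp [DistLE.refl, hJ.singleton x (Finset.singleton_subset_iff.1 hXS)]

theorem SpannedFrom.mono (hc : c ≤ c') (h : SpannedFrom I S β J x X c) :
    SpannedFrom I S β J x X c' := by
  refine ⟨h.1.trans hc, fun hX => ?_⟩
  obtain ⟨hXS, v, e, d, hd, hsp, hle⟩ := h.2 hX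
  exact ⟨hXS, v, e, d, hd, hsp, hle.trans hc⟩

theorem SpannedFrom.edge {y : V} (hadj : I.graph.Adj x y) (h : SpannedFrom I S β J y X c) :
    SpannedFrom I S β J x X (I.cost s(x, y) + c) := by
  refine ⟨add_nonneg (I.cost_nonneg _ hadj) h.1, fun hX => ?_⟩
  obtain ⟨hXS, v, e, d, hd, hsp, hle⟩ := h.2 hX
  exact ⟨hXS, v, I.cost s(x, y) + e, d, (DistLE.of_adj hadj).trans hd, hsp, by linarith⟩

theorem SpannedFrom.join (hJ : IsStarBounded I S β J) (hβ : 0 ≤ β) (h : SpannedFrom I S β J x X c)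
    (h' : SpannedFrom I S β J x Y c') : SpannedFrom I S β J x (X ∪ Y) (c + c') := by
  rcases X.eq_empty_or_nonempty with rfl | hX
  · exact (Finset.empty_union Y).symm ▸ h'.mono (le_add_of_nonneg_left h.1)
  rcases Y.eq_empty_or_nonempty with rfl | hY
  · exact (Finset.union_empty X).symm ▸ h.mono (le_add_of_nonneg_right h'.1)
  obtain ⟨hXS, v, e, d, hd, hsp, hle⟩ := h.2 hX
  obtain ⟨hYS, w, e', d', hd', hsp', hle'⟩ := h'.2 hY
  exact ⟨add_nonneg h.1 h'.1, fun _ => ⟨Finset.union_subset hXS hYS, x, 0, _, .refl x,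
    hsp.join hJ hβ hXS hYS hd hd' hsp', by linarith⟩⟩

theorem SpannedFrom.six_mul_le (hJ : IsStarBounded I S β J) (hβ : 0 ≤ β) (hX : X.Nonempty)
    (h : SpannedFrom I S β J x X c) : 6 * J X ≤ (5 + β) * c := by
  obtain ⟨hXS, v, e, c', hd, ⟨X₁, X₂, q₁, q₂, a₁, a₂, hq₁, hq₂, rfl, hd₁, hd₂, hle⟩, hc⟩ :=
    h.2 hX
  have hunion := hJ.le_pair hq₁ hq₂
  have hpair := hJ.two_mul_pair_le (hXS (Finset.mem_union_left _ hq₁))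
    (hXS (Finset.mem_union_right _ hq₂)) hd₁ hd₂
  have ha₁ := mul_nonneg (by linarith : 0 ≤ 2 + β) hd₁.nonneg
  have hcost := mul_le_mul_of_nonneg_left (by linarith [hd.nonneg] : c' ≤ c)
    (by linarith : 0 ≤ 5 + β)
  linarith

end Decomposition

section Contraction

variable {W : Type*} [Fintype W] {G : SimpleGraph W} {y z : W}

theorem sum_edges_induce_add_le {f : Sym2 W → ℝ} (hf : ∀ e ∈ G.edgeSet, 0 ≤ f e)
    (h : G.Adj y z) :
    ∑ e : Sym2 ({z}ᶜ : Set W) with e ∈ (G.induce {z}ᶜ).edgeSet, f (e.map Subtype.val) +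
      f s(y, z) ≤ ∑ e with e ∈ G.edgeSet, f e := by
  rw [← Finset.sum_image (f := f) (g := Sym2.map Subtype.val)
    (Sym2.map.injective Subtype.val_injective).injOn, add_comm, ← Finset.sum_insert]
  · refine Finset.sum_le_sum_of_subset_of_nonneg ?_ fun e he _ => hf e (Finset.mem_filter.1 he).2
    refine Finset.insert_subset (Finset.mem_filter.2 ⟨Finset.mem_univ _, h⟩)
      (Finset.image_subset_iff.2 fun e he => ?_)
    induction e
    simpa using he
  · rw [Finset.mem_image]
    rintro ⟨e, -, he⟩
    obtain ⟨a, -, ha⟩ := Sym2.mem_map.1 (he ▸ Sym2.mem_mk_right y z)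
    exact a.2 ha

theorem sum_compl_singleton_add_ite (c : W → ℝ) (hyz : y ∈ ({z}ᶜ : Set W)) (d : ℝ) :
    ∑ a : ({z}ᶜ : Set W), (c a + if a = ⟨y, hyz⟩ then d + c z else 0) = ∑ a, c a + d := by
  rw [Finset.sum_add_distrib, Finset.sum_ite_eq', if_pos (Finset.mem_univ _),
    ← Finset.sum_subtype {z}ᶜ (by simp) c, ← Finset.sum_compl_add_sum {z} c, Finset.sum_singleton]
  ring

theorem sup_compl_singleton_sup_ite {α : Type*} [SemilatticeSup α] [OrderBot α] (X : W → α)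
    (hyz : y ∈ ({z}ᶜ : Set W)) :
    Finset.univ.sup (fun a : ({z}ᶜ : Set W) => X a ⊔ if a = ⟨y, hyz⟩ then X z else ⊥) =
      Finset.univ.sup X := by
  refine eq_of_forall_ge_iff fun u => ?_
  simp only [Finset.sup_le_iff, Finset.mem_univ, true_imp_iff, sup_le_iff]
  refine ⟨fun h a => ?_, fun h a => ⟨h a, ?_⟩⟩
  · by_cases ha : a = z
    · simpa [ha] using (h ⟨y, hyz⟩).2
    · exact (h ⟨a, ha⟩).1
  · split_ifs
    exacts [h z, bot_le]

/-- Contract the edges of `G` one after the other: a vertex `z` whose removal keeps `G` connected is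
merged into one of its neighbours. -/
theorem exists_sup_of_connected {α : Type*} [SemilatticeSup α] [OrderBot α] (hG : G.Connected)
    {f : Sym2 W → ℝ} (hf : ∀ e ∈ G.edgeSet, 0 ≤ f e) {P : W → α → ℝ → Prop}
    (hmono : ∀ {u X c c'}, c ≤ c' → P u X c → P u X c')
    (hedge : ∀ {u w X c}, G.Adj u w → P w X c → P u X (f s(u, w) + c))
    (hjoin : ∀ {u X Y c c'}, P u X c → P u Y c' → P u (X ⊔ Y) (c + c'))
    {X : W → α} {c : W → ℝ} (hX : ∀ u, P u (X u) (c u)) :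
    ∃ u, P u (Finset.univ.sup X) (∑ u, c u + ∑ e with e ∈ G.edgeSet, f e) := by
  induction hn : Fintype.card W generalizing W with
  | zero => exact absurd hn (Fintype.card_pos_iff.2 hG.nonempty).ne'
  | succ n ih =>
    rcases subsingleton_or_nontrivial W with hW | hW
    · obtain ⟨a⟩ := hG.nonempty
      have : Unique W := ⟨⟨a⟩, fun b => Subsingleton.elim b a⟩
      refine ⟨default, hmono ?_ (by simpa using hX default)⟩
      simp
    · obtain ⟨z, hz⟩ := hG.exists_connected_induce_compl_singleton_of_finite_nontrivial
      obtain ⟨y, hzy⟩ := hG.preconnected.exists_adj_of_nontrivial z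
      have hyz : y ∈ ({z}ᶜ : Set W) := hzy.ne'
      have hf' : ∀ e ∈ (G.induce {z}ᶜ).edgeSet, 0 ≤ f (e.map Subtype.val) := by
        intro e he
        induction e
        exact hf _ he
      have hX' : ∀ a : ({z}ᶜ : Set W), P a (X a ⊔ if a = ⟨y, hyz⟩ then X z else ⊥)
          (c a + if a = ⟨y, hyz⟩ then f s(y, z) + c z else 0) := by
        intro a
        split_ifs with ha
        · exact ha ▸ hjoin (hX y) (hedge hzy.symm (hX z))
        · simpa using hX a
      obtain ⟨u, hu⟩ := ih hz hf' (P := fun a => P a) hmono hedge hjoin hX'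
        (by rw [Fintype.card_compl_set]; simp [hn])
      rw [sup_compl_singleton_sup_ite, sum_compl_singleton_add_ite] at hu
      refine ⟨u, hmono ?_ hu⟩
      rw [add_assoc, add_comm (f s(y, z))]
      refine add_le_add_right ?_ _
      convert sum_edges_induce_add_le hf hzy.symm

end Contraction

theorem IsStarBounded.six_mul_le_edgeCost {V : Type*} [Fintype V] {I : SteinerForest V}
    {S : Finset V} {β : ℝ} {J : Finset V → ℝ} (hJ : IsStarBounded I S β J) (hβ : 0 ≤ β)
    (hS : S.Nonempty) {F : SimpleGraph V} (hF : F ≤ I.graph) (T : F.Subgraph)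
    (hST : (S : Set V) ⊆ T.verts) (hT : T.coe.Connected) :
    6 * J S ≤ (5 + β) * I.edgeCost T.edgeSet := by
  have hadj : ∀ {a b}, T.coe.Adj a b → I.graph.Adj a b := fun h => hF (T.adj_sub h)
  have hcost : ∀ e ∈ T.edgeSet, 0 ≤ I.cost e := fun e he =>
    I.cost_nonneg e (SimpleGraph.edgeSet_mono hF (T.edgeSet_subset he))
  have hedge : ∀ e : Sym2 T.verts, e ∈ T.coe.edgeSet → e.map Subtype.val ∈ T.edgeSet := by
    intro e he
    induction e
    exact he
  obtain ⟨x, hx⟩ := exists_sup_of_connected hT (f := fun e => I.cost (e.map Subtype.val))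
    (P := fun a => SpannedFrom I S β J a) (X := fun a => S ∩ {(a : V)}) (c := fun _ => 0)
    (fun e he => hcost _ (hedge e he)) SpannedFrom.mono (fun h => SpannedFrom.edge (hadj h))
    (SpannedFrom.join hJ hβ) fun a => .of_subset_singleton hJ Finset.inter_subset_left
      Finset.inter_subset_right
  have hsup : Finset.univ.sup (fun a : T.verts => S ∩ {(a : V)}) = S := by
    ext u
    simpa [Finset.mem_sup] using @hST u
  rw [hsup] at hx
  refine (hx.six_mul_le hJ hβ hS).trans (mul_le_mul_of_nonneg_left ?_ (by linarith))
  rw [Finset.sum_const_zero, zero_add, edgeCost,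
    ← Finset.sum_image (f := I.cost) (Sym2.map.injective Subtype.val_injective).injOn]
  exact Finset.sum_le_sum_of_subset_of_nonneg (Finset.image_subset_iff.2 fun e he =>
    Finset.mem_filter.2 ⟨Finset.mem_univ _, hedge e (Finset.mem_filter.1 he).2⟩)
    fun e he _ => hcost e (Finset.mem_filter.1 he).2

/-! ### Priority-based assignments -/

section Assignment

variable {V : Type*} [Fintype V] {I : SteinerForest V} {R : MoatRule V} {s : MoatState V}
  {A B S : Finset V} {rank : V → ℕ} {r : Finset V → V → ℝ} {top u v : V}

theorem touched_union_add_one_le (h : (A ∩ B).Nonempty) :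
    I.touched s (A ∪ B) + 1 ≤ I.touched s A + I.touched s B := by
  unfold touched
  rw [Finset.image_union, ← Finset.card_union_add_card_inter]
  exact Nat.add_le_add_left
    (Finset.card_pos.2 ((h.image _).mono (Finset.image_inter_subset _ _ _))) _

theorem excess_singleton (H : ℝ) (u : V) : I.excess R H {u} = 0 := by simp [excess, touched]

theorem excess_union_le {H : ℝ} (hH : 0 ≤ H) (h : (A ∩ B).Nonempty) :
    I.excess R H (A ∪ B) ≤ I.excess R H A + I.excess R H B := by
  have hint := I.intervalIntegrable_touched_sub_one R (a := 0) (c := H)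
  unfold excess
  rw [← intervalIntegral.integral_add (hint A) (hint B)]
  refine intervalIntegral.integral_mono_on_of_le_Ioo hH (hint _) ((hint A).add (hint B))
    fun y _ => ?_
  have hle : (I.touched (I.stateAt R y) (A ∪ B) : ℝ) + 1 ≤
      I.touched (I.stateAt R y) A + I.touched (I.stateAt R y) B := by
    exact_mod_cast touched_union_add_one_le h
  linarith

theorem excess_moment {n : ℕ} (hn : n ≤ I.lastStage R) (S : Finset V) :
    I.excess R (I.moment R n) S = ∑ k ∈ Finset.range n,
      (I.moment R (k + 1) - I.moment R k) * ((I.touched (I.stage R k) S : ℝ) - 1) :=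
  integral_stateAt_moment (fun s => (I.touched s S : ℝ) - 1) hn

theorem priorityLT_iff :
    I.PriorityLT rank u v ↔ toLex (I.legacyTime u, rank u) < toLex (I.legacyTime v, rank v) := by
  rw [Prod.Lex.toLex_lt_toLex]
  rfl

theorem PriorityLT.asymm (h : I.PriorityLT rank u v) : ¬ I.PriorityLT rank v u := by
  rw [priorityLT_iff] at h ⊢
  exact h.asymm

theorem exists_highest_priority (I : SteinerForest V) (rank : V → ℕ) (hS : S.Nonempty) :
    ∃ v ∈ S, ∀ u ∈ S, ¬ I.PriorityLT rank v u := by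
  obtain ⟨v, hv, hmax⟩ := S.exists_max_image (fun v => toLex (I.legacyTime v, rank v)) hS
  exact ⟨v, hv, fun u hu => priorityLT_iff.not.2 (hmax u hu).not_gt⟩

theorem IsPriorityBased.eq_of_pos (hrS : I.IsPriorityBased rank r S) (hu : u ∈ S) (hv : v ∈ S)
    (hru : 0 < r A u) (hrv : 0 < r A v) : u = v := by
  by_contra hne
  obtain ⟨huA, hu_max⟩ := hrS A u hu hru
  obtain ⟨hvA, hv_max⟩ := hrS A v hv hrv
  exact (hv_max u hu huA hne).asymm (hu_max v hv hvA (Ne.symm hne))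

theorem IsPriorityBased.sum_erase_le (hrS : I.IsPriorityBased rank r S)
    (hr : I.IsAssignment R r) (htop : top ∈ S) (hmax : ∀ u ∈ S, ¬ I.PriorityLT rank top u)
    (A : Finset V) :
    ∑ v ∈ S.erase top, r A v ≤ if (S ∩ A).Nonempty ∧ top ∉ A then I.finalGrowth R A else 0 := by
  by_cases h : ∃ v ∈ S.erase top, 0 < r A v
  · obtain ⟨v, hv, hpos⟩ := h
    obtain ⟨hne, hvS⟩ := Finset.mem_erase.1 hv
    obtain ⟨hvA, hv_max⟩ := hrS A v hvS hpos
    rw [Finset.sum_eq_single_of_mem v hv fun u hu huv => (hr A u).1.antisymm' <| not_lt.1 fun hru =>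
      huv (hrS.eq_of_pos (Finset.mem_of_mem_erase hu) hvS hru hpos),
      if_pos ⟨⟨v, Finset.mem_inter.2 ⟨hvS, hvA⟩⟩, fun hmem => hmax v hvS
        (hv_max top htop hmem hne.symm)⟩]
    exact (hr A v).2.1
  · push Not at h
    refine (Finset.sum_nonpos h).trans ?_
    split_ifs
    exacts [(hr A top).1.trans (hr A top).2.1, le_rfl]

theorem card_activeSets_filter_add_one_le (hu : u ∈ S) :
    {A ∈ I.activeSets R s | (S ∩ A).Nonempty ∧ u ∉ A}.card + 1 ≤ I.touched s S := by
  have hmem : I.component s u ∈ S.image (I.component s) := Finset.mem_image_of_mem _ hu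
  have hsub : {A ∈ I.activeSets R s | (S ∩ A).Nonempty ∧ u ∉ A} ⊆
      (S.image (I.component s)).erase (I.component s u) := by
    intro A hA
    obtain ⟨hA, ⟨v, hv⟩, huA⟩ := Finset.mem_filter.1 hA
    obtain ⟨hvS, hvA⟩ := Finset.mem_inter.1 hv
    refine Finset.mem_erase.2 ⟨?_, Finset.mem_image.2 ⟨v, hvS, component_of_mem_activeSets hA hvA⟩⟩
    rintro rfl
    exact huA (mem_component_iff.2 (.refl u))
  rw [touched, ← Finset.card_erase_add_one hmem]
  exact Nat.add_le_add_right (Finset.card_le_card hsub) 1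

theorem IsPriorityBased.sum_erase_assigned_le (hrS : I.IsPriorityBased rank r S)
    (hr : I.IsAssignment R r) (htop : top ∈ S) (hmax : ∀ u ∈ S, ¬ I.PriorityLT rank top u) {n : ℕ}
    (hn : n ≤ I.lastStage R) (hconn : ∀ u ∈ S, ∀ v ∈ S, I.Connected (I.stage R n) u v) :
    ∑ v ∈ S.erase top, assigned r v ≤ I.excess R (I.moment R n) S := by
  have hlen : ∀ k, 0 ≤ I.moment R (k + 1) - I.moment R k := fun k =>
    sub_nonneg.2 (I.moment_mono R k.le_succ)
  have hzero : ∀ k ∉ Finset.range n,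
      {A ∈ I.activeSets R (I.stage R k) | (S ∩ A).Nonempty ∧ top ∉ A}.card = 0 := by
    intro k hk
    have hle := touched_le_one fun u hu v hv => (hconn u hu v hv).mono
      (I.fullyColoured_stage_mono R (not_lt.1 (Finset.mem_range.not.1 hk)))
    have hlt := card_activeSets_filter_add_one_le (I := I) (R := R) (s := I.stage R k) htop
    omega
  calc ∑ v ∈ S.erase top, assigned r v
      = ∑ A, ∑ v ∈ S.erase top, r A v := Finset.sum_comm
    _ ≤ ∑ A with (S ∩ A).Nonempty ∧ top ∉ A, I.finalGrowth R A := by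
        rw [Finset.sum_filter]
        exact Finset.sum_le_sum fun A _ => hrS.sum_erase_le hr htop hmax A
    _ = ∑ k ∈ Finset.range n, (I.moment R (k + 1) - I.moment R k) *
          {A ∈ I.activeSets R (I.stage R k) | (S ∩ A).Nonempty ∧ top ∉ A}.card := by
        unfold finalGrowth
        rw [sum_growth_eq_sum]
        refine (Finset.sum_subset (Finset.range_mono hn) fun k _ hk => ?_).symm
        rw [hzero k hk, Nat.cast_zero, mul_zero]
    _ ≤ I.excess R (I.moment R n) S := by
        rw [excess_moment hn]
        refine Finset.sum_le_sum fun k _ => mul_le_mul_of_nonneg_left ?_ (hlen k)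
        rw [le_sub_iff_add_le]
        exact_mod_cast card_activeSets_filter_add_one_le htop

theorem sum_assigned_sub_sup_le (hS : S.Nonempty) (hr : I.IsAssignment R r)
    (hrS : I.IsPriorityBased rank r S) {n : ℕ} (hn : n ≤ I.lastStage R)
    (hconn : ∀ u ∈ S, ∀ v ∈ S, I.Connected (I.stage R n) u v) :
    ∑ v ∈ S, assigned r v - S.sup' hS (assigned r) ≤ I.excess R (I.moment R n) S := by
  obtain ⟨top, htop, hmax⟩ := exists_highest_priority I rank hS
  rw [← Finset.add_sum_erase S _ htop]
  linarith [Finset.le_sup' (assigned r) htop, hrS.sum_erase_assigned_le hr htop hmax hn hconn]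

end Assignment

section Main

variable {V : Type*} [Fintype V] {I : SteinerForest V} {β : ℝ} {t b : V → ℝ} {S : Finset V}

theorem isStarBounded_excess (hβ : 0 ≤ β) (hb : I.IsLocalOptimum β t b) {n : ℕ}
    (hact : ∀ m < n, ∀ v ∈ S, I.IsActive (boostedRule t b) (I.stage (boostedRule t b) m) v) :
    IsStarBounded I S β (I.excess (boostedRule t b) (I.moment (boostedRule t b) n)) where
  singleton u _ := excess_singleton _ u
  union _ _ h := excess_union_le (I.moment_nonneg _ n) h
  star v q₁ hq₁ q₂ hq₂ q₃ hq₃ a₁ a₂ a₃ hd₁ hd₂ hd₃ := by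
    have hqS : ∀ i, ![q₁, q₂, q₃] i ∈ S := by simp [Fin.forall_fin_succ, hq₁, hq₂, hq₃]
    have hd : ∀ i, I.DistLE (![a₁, a₂, a₃] i) v (![q₁, q₂, q₃] i) := by
      simp [Fin.forall_fin_succ, hd₁, hd₂, hd₃]
    have himage : Finset.univ.image ![q₁, q₂, q₃] = {q₁, q₂, q₃} := by
      ext
      simp [Fin.exists_fin_succ, eq_comm]
    simpa [himage, Fin.sum_univ_three] using two_mul_excess_star_le hβ hb (I.moment_nonneg _ n)
      (fun i y hy hyn => hact _ (stageAt_lt hy hyn) _ (hqS i)) hd 0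

theorem ActivelyConnected.exists_le_lastStage (hS : S.Nonempty)
    (h : I.ActivelyConnected (boostedRule t b) S) :
    ∃ n ≤ I.lastStage (boostedRule t b),
      (∀ u ∈ S, ∀ v ∈ S, I.Connected (I.stage (boostedRule t b) n) u v) ∧
      ∀ m < n, ∀ v ∈ S, I.IsActive (boostedRule t b) (I.stage (boostedRule t b) m) v := by
  obtain ⟨n, hconn, hact⟩ := h
  refine ⟨n, ?_, fun u hu v hv => component_eq_iff_connected.1 (hconn u hu v hv), hact⟩
  by_contra! hn
  obtain ⟨u, hu⟩ := hS
  exact Finset.notMem_empty _ (activeSets_lastStage_boostedRule t b ▸ hact _ hn u hu)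

end Main

end

end SteinerForest

theorem mainTheorem4_general {V : Type*} [Fintype V] (I : SteinerForest V) {β : ℝ} (hβ : 0 ≤ β)
    {t b : V → ℝ} (hb : I.IsLocalOptimum β t b) {S : Finset V} (hS : S.Nonempty)
    (hSact : I.ActivelyConnected (SteinerForest.boostedRule t b) S) {rank : V → ℕ}
    {r : Finset V → V → ℝ} (hr : I.IsAssignment (SteinerForest.boostedRule t b) r)
    (hrS : I.IsPriorityBased rank r S)
    {F : SimpleGraph V} (hF : F ≤ I.graph) (T : F.Subgraph) (hST : (S : Set V) ⊆ T.verts)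
    (hT : T.coe.Connected) :
    6 / (5 + β) * (∑ v ∈ S, SteinerForest.assigned r v - S.sup' hS (SteinerForest.assigned r)) ≤
      I.edgeCost T.edgeSet := by
  obtain ⟨n, hn, hconn, hact⟩ := hSact.exists_le_lastStage hS
  have hassigned := SteinerForest.sum_assigned_sub_sup_le hS hr hrS hn hconn
  have hcost := (SteinerForest.isStarBounded_excess hβ hb hact).six_mul_le_edgeCost
    hβ hS hF T hST hT
  rw [div_mul_eq_mul_div, div_le_iff₀ (by linarith)]
  linarith

theorem mainTheorem4 {V : Type*} [Fintype V] (I : SteinerForest V)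
    (opt : SimpleGraph V) (hopt : I.IsOPT opt)
    (rank : V → ℕ) (hrank : I.IsTieBreaker rank)
    (β : ℝ) (hβ0 : 0 < β) (hβ1 : β < 1)
    (t b : V → ℝ) (ht : ∀ v, 0 ≤ t v) (hb : I.IsLocalSearchOutput β t b)
    (S : Finset V) (hS : S.Nonempty)
    (hSopt : ∀ u ∈ S, ∀ v ∈ S, opt.Reachable u v)
    (hSact : I.ActivelyConnected (SteinerForest.boostedRule t b) S)
    (r : Finset V → V → ℝ) (hr : I.IsAssignment (SteinerForest.boostedRule t b) r)
    (hrS : I.IsPriorityBased rank r S)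
    (T : opt.Subgraph) (hT : SteinerForest.IsMinimalSubtree opt S T) :
    6 / (5 + β) * (∑ v ∈ S, SteinerForest.assigned r v - S.sup' hS (SteinerForest.assigned r)) ≤
      I.edgeCost T.edgeSet :=
  mainTheorem4_general I hβ0.le hb.2 hS hSact hr hrS hopt.1.1 T hT.prop.1
    hT.prop.2.connected
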